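/- A prop is a strict symmetric monoidal category whose objects are the natural numbers, with tensor product of objects given by addition; a morphism of props is a strict symmetric monoidal functor that is the identity on objects. Let $k$ be a field. Let $\Sigma$ be the signature with generators $m\colon 2\to 1$, $i\colon 0\to 1$, $d\colon 1\to 2$, $e\colon 1\to 0$, and regard $k$ as a signature with one generator $1\to 1$ for each element of $k$. Write $F(-)$ for the free prop on a signature and $+$ for the coproduct of props. Put $$\widetilde{\mathrm{Circ}}_k = F(\Sigma)+F(k),\qquad \mathrm{SigFlow}_k = F(\Sigma)+F(\Sigma)+F(k).$$ The generators of $\mathrm{SigFlow}_k$ are called coduplication $\Delta^\dagger\colon 2\to 1$, codeletion $!^\dagger\colon 0\to 1$, duplication $\Delta\colon 1\to 2$, deletion $!\colon 1\to 0$ (the first copy of $\Sigma$), addition $+\colon 2\to 1$, zero $0\colon 0\to 1$, coaddition $+^\dagger\colon 1\to 2$, cozero $0^\dagger\colon 1\to 0$ (the second copy), and scalar multiplication $c\colon 1\to 1$ for each $c\in k$. Let $\mathrm{Circ}_k$ be the prop whose morphisms $m\to n$ are the isomorphism classes of finite directed graphs with edges labelled by elements of $k$ and with set of nodes $N$, together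 with a cospan of finite sets $\{1,\dots,m\}\to N\leftarrow\{1,\dots,n\}$; composition is by pushout and the tensor product is disjoint union. Let $P\colon\widetilde{\mathrm{Circ}}_k\to\mathrm{Circ}_k$ be the morphism of props that sends $m,i,d,e$ to the circuits with one node and no edges, and $Z\in k$ to the circuit with two nodes and a single edge, labelled $Z$, from the input node to the output node. Let $\mathrm{FinRel}_k$ be the prop whose morphisms $m\to n$ are the linear relations from $k^m$ to $k^n$, i.e. the linear subspaces of $k^m\oplus k^n$, with tensor product given by direct sum. Let $\mathrm{LagRel}_k$ be the prop whose morphisms $m\to n$ are the Lagrangian (i.e. maximal isotropic) subspaces of $\overline{(k\oplus k)^m}\oplus(k\oplus k)^n$, where $(k\oplus k)^n$ carries the symplectic form $\omega\big((\phi,I),(\phi',I')\big)=\sum_j(\phi_jI'_j-\phi'_jI_j)$ and the bar means that the sign of the form is changed. The inclusion $\mathrm{LagRel}_k\hookrightarrow\mathrm{FinRel}_k$ is the strict symmetric monoidal functor that sends $n$ to $2n$ by reading $(k\oplus k)^n$ as $k^{2n}$ with coordinates $(\phi_1,I_1,\phi_2,I_2,\dots)$. Let $\blacksquare\colon\mathrm{Circ}_k\to\mathrm{LagRel}_k$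 be the black-boxing morphism of props. It sends a circuit to the relation between the potentials and currents at its inputs and at its outputs that consists of all values that extend to potentials on the nodes and currents on the edges obeying Ohm's law (the potential at the target of an edge minus that at its source equals the label times the current) and Kirchhoff's current law. In particular $$\begin{aligned} \blacksquare(m)&=\{(\phi_1,I_1,\phi_2,I_2,\phi_3,I_3):\phi_1=\phi_2=\phi_3,\ I_1+I_2=I_3\}, & \blacksquare(i)&=\{(\phi_2,I_2):I_2=0\},\\ \blacksquare(d)&=\{(\phi_1,I_1,\phi_2,I_2,\phi_3,I_3):\phi_1=\phi_2=\phi_3,\ I_1=I_2+I_3\}, & \blacksquare(e)&=\{(\phi_1,I_1):I_1=0\},\\ \blacksquare(Z)&=\{(\phi_1,I_1,\phi_2,I_2):\phi_2-\phi_1=ZI_1,\ I_1=I_2\}. \end{aligned}$$ Let $\square\colon\mathrm{SigFlow}_k\to\mathrm{FinRel}_k$ be the morphism of props that sends $\Delta,!,+,0,c$ to the graphs of the linear maps $x\mapsto(x,x)$, $k\to\{0\}$, $(x,y)\mapsto x+y$, $\{0\}\to k$, $x\mapsto cx$ respectively, and $\Delta^\dagger,!^\dagger,+^\dagger,0^\dagger$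 to the converses of the graphs for $\Delta,!,+,0$. **Theorem.** For any field $k$ there is a strict symmetric monoidal functor $T\colon\widetilde{\mathrm{Circ}}_k\to\mathrm{SigFlow}_k$, sending the object $1$ to the object $2$, such that the square of strict symmetric monoidal functors $$\begin{array}{ccc} \widetilde{\mathrm{Circ}}_k & \xrightarrow{\ P\ }\ \mathrm{Circ}_k\ \xrightarrow{\ \blacksquare\ } & \mathrm{LagRel}_k\\ {\scriptstyle T}\downarrow & & \downarrow\\ \mathrm{SigFlow}_k & \xrightarrow{\qquad\square\qquad} & \mathrm{FinRel}_k \end{array}$$ commutes: $\square\circ T$ equals the composite of $P$, $\blacksquare$ and the inclusion $\mathrm{LagRel}_k\hookrightarrow\mathrm{FinRel}_k$. -/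

import Mathlib

universe u v w

namespace CircuitProps


section Props

/-- Transport of a morphism along equalities of its source and its target. -/
def castHom {H : ℕ → ℕ → Type u} {m m' n n' : ℕ} (hm : m = m') (hn : n = n') (f : H m n) :
    H m' n' :=
  hn ▸ hm ▸ f

/-- A prop: a strict symmetric monoidal category whose objects are the natural numbers, with
tensor product of objects given by addition.  Composition is written in diagrammatic order. -/
structure PROP where
  Hom : ℕ → ℕ → Type u
  id : ∀ n, Hom n n
  comp : ∀ {l m n}, Hom l m → Hom m n → Hom l n
  tensor : ∀ {m n m' n'}, Hom m n → Hom m' n' → Hom (m + m') (n + n')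
  braid : ∀ m n, Hom (m + n) (n + m)
  id_comp : ∀ {m n} (f : Hom m n), comp (id m) f = f
  comp_id : ∀ {m n} (f : Hom m n), comp f (id n) = f
  assoc : ∀ {l m n p} (f : Hom l m) (g : Hom m n) (h : Hom n p),
    comp (comp f g) h = comp f (comp g h)
  tensor_id : ∀ m n, tensor (id m) (id n) = id (m + n)
  tensor_comp : ∀ {l m n l' m' n'} (f : Hom l m) (g : Hom m n) (f' : Hom l' m') (g' : Hom m' n'),
    tensor (comp f g) (comp f' g') = comp (tensor f f') (tensor g g')
  tensor_assoc : ∀ {m n m' n' m'' n''} (f : Hom m n) (g : Hom m' n') (h : Hom m'' n''),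
    castHom (add_assoc m m' m'') (add_assoc n n' n'') (tensor (tensor f g) h) =
      tensor f (tensor g h)
  id_zero_tensor : ∀ {m n} (f : Hom m n),
    castHom (zero_add m) (zero_add n) (tensor (id 0) f) = f
  tensor_id_zero : ∀ {m n} (f : Hom m n),
    castHom (add_zero m) (add_zero n) (tensor f (id 0)) = f
  braid_natural : ∀ {m n m' n'} (f : Hom m n) (g : Hom m' n'),
    comp (tensor f g) (braid n n') = comp (braid m m') (tensor g f)
  braid_symm : ∀ m n, comp (braid m n) (braid n m) = id (m + n)
  braid_zero : ∀ n, castHom (zero_add n) (add_zero n) (braid 0 n) = id n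
  hexagon : ∀ m n p,
    castHom (add_assoc m n p).symm (add_assoc n p m) (braid m (n + p)) =
      comp (castHom rfl (add_assoc n m p) (tensor (braid m n) (id p)))
        (tensor (id n) (braid m p))

/-- A strict symmetric monoidal functor between props. -/
structure StrictFunctor (P : PROP.{u}) (Q : PROP.{v}) where
  obj : ℕ → ℕ
  map : ∀ {m n}, P.Hom m n → Q.Hom (obj m) (obj n)
  obj_zero : obj 0 = 0
  obj_add : ∀ m n, obj (m + n) = obj m + obj n
  map_id : ∀ n, map (P.id n) = Q.id (obj n)
  map_comp : ∀ {l m n} (f : P.Hom l m) (g : P.Hom m n),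
    map (P.comp f g) = Q.comp (map f) (map g)
  map_tensor : ∀ {m n m' n'} (f : P.Hom m n) (g : P.Hom m' n'),
    castHom (obj_add m m') (obj_add n n') (map (P.tensor f g)) = Q.tensor (map f) (map g)
  map_braid : ∀ m n,
    castHom (obj_add m n) (obj_add n m) (map (P.braid m n)) = Q.braid (obj m) (obj n)

/-- A morphism of props: a strict symmetric monoidal functor that is the identity on objects. -/
structure PropHom (P : PROP.{u}) (Q : PROP.{v}) where
  map : ∀ {m n}, P.Hom m n → Q.Hom m n
  map_id : ∀ n, map (P.id n) = Q.id n
  map_comp : ∀ {l m n} (f : P.Hom l m) (g : P.Hom m n),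
    map (P.comp f g) = Q.comp (map f) (map g)
  map_tensor : ∀ {m n m' n'} (f : P.Hom m n) (g : P.Hom m' n'),
    map (P.tensor f g) = Q.tensor (map f) (map g)
  map_braid : ∀ m n, map (P.braid m n) = Q.braid m n

/-- A morphism of props, seen as a strict symmetric monoidal functor. -/
def PropHom.toStrictFunctor {P : PROP.{u}} {Q : PROP.{v}} (F : PropHom P Q) :
    StrictFunctor P Q where
  obj n := n
  map f := F.map f
  obj_zero := rfl
  obj_add _ _ := rfl
  map_id := F.map_id
  map_comp := F.map_comp
  map_tensor := F.map_tensor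
  map_braid := F.map_braid

theorem castHom_castHom {H : ℕ → ℕ → Type u} {m m' m'' n n' n'' : ℕ} (hm : m = m') (hn : n = n')
    (hm' : m' = m'') (hn' : n' = n'') (f : H m n) :
    castHom hm' hn' (castHom hm hn f) = castHom (hm.trans hm') (hn.trans hn') f := by
  subst hm hn hm' hn'; rfl

theorem StrictFunctor.map_castHom {P : PROP.{u}} {Q : PROP.{v}} (F : StrictFunctor P Q)
    {m m' n n' : ℕ} (hm : m = m') (hn : n = n') (f : P.Hom m n) :
    F.map (castHom hm hn f) = castHom (congrArg F.obj hm) (congrArg F.obj hn) (F.map f) := by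
  subst hm hn; rfl

/-- Composition of strict symmetric monoidal functors: first `F`, then `G`. -/
def StrictFunctor.comp {P : PROP.{u}} {Q : PROP.{v}} {R : PROP.{w}} (F : StrictFunctor P Q)
    (G : StrictFunctor Q R) : StrictFunctor P R where
  obj n := G.obj (F.obj n)
  map f := G.map (F.map f)
  obj_zero := by rw [F.obj_zero, G.obj_zero]
  obj_add m n := by rw [F.obj_add, G.obj_add]
  map_id n := by rw [F.map_id, G.map_id]
  map_comp f g := by rw [F.map_comp, G.map_comp]
  map_tensor f g := by
    rw [← G.map_tensor, ← F.map_tensor, G.map_castHom, castHom_castHom]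
  map_braid m n := by
    rw [← G.map_braid, ← F.map_braid, G.map_castHom, castHom_castHom]

end Props

section Free

/-- A signature: a family of sets of generators `m ⟶ n`. -/
abbrev Signature := ℕ → ℕ → Type u

/-- The disjoint union of two signatures. -/
def Signature.sum (S : Signature.{u}) (S' : Signature.{v}) : Signature.{max u v} :=
  fun m n => S m n ⊕ S' m n

/-- Formal expressions in the generators of a signature and the operations of a prop. -/
inductive Term (S : Signature.{u}) : ℕ → ℕ → Type u
  | gen {m n : ℕ} (s : S m n) : Term S m n
  | id (n : ℕ) : Term S n n
  | comp {l m n : ℕ} (f : Term S l m) (g : Term S m n) : Term S l n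
  | tensor {m n m' n' : ℕ} (f : Term S m n) (g : Term S m' n') : Term S (m + m') (n + n')
  | braid (m n : ℕ) : Term S (m + n) (n + m)

/-- The smallest congruence on formal expressions for which the laws of a prop hold. -/
inductive Term.Rel {S : Signature.{u}} : ∀ {m n : ℕ}, Term S m n → Term S m n → Prop
  | refl {m n} (f : Term S m n) : Rel f f
  | symm {m n} {f g : Term S m n} : Rel f g → Rel g f
  | trans {m n} {f g h : Term S m n} : Rel f g → Rel g h → Rel f h
  | comp_congr {l m n} {f f' : Term S l m} {g g' : Term S m n} :
      Rel f f' → Rel g g' → Rel (f.comp g) (f'.comp g')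
  | tensor_congr {m n m' n'} {f f' : Term S m n} {g g' : Term S m' n'} :
      Rel f f' → Rel g g' → Rel (f.tensor g) (f'.tensor g')
  | id_comp {m n} (f : Term S m n) : Rel ((id m).comp f) f
  | comp_id {m n} (f : Term S m n) : Rel (f.comp (id n)) f
  | assoc {l m n p} (f : Term S l m) (g : Term S m n) (h : Term S n p) :
      Rel ((f.comp g).comp h) (f.comp (g.comp h))
  | tensor_id (m n) : Rel ((id m).tensor (id n)) (id (m + n))
  | tensor_comp {l m n l' m' n'} (f : Term S l m) (g : Term S m n)
      (f' : Term S l' m') (g' : Term S m' n') :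
      Rel ((f.comp g).tensor (f'.comp g')) ((f.tensor f').comp (g.tensor g'))
  | tensor_assoc {m n m' n' m'' n''} (f : Term S m n) (g : Term S m' n') (h : Term S m'' n'') :
      Rel (castHom (add_assoc m m' m'') (add_assoc n n' n'') ((f.tensor g).tensor h))
        (f.tensor (g.tensor h))
  | id_zero_tensor {m n} (f : Term S m n) :
      Rel (castHom (zero_add m) (zero_add n) ((id 0).tensor f)) f
  | tensor_id_zero {m n} (f : Term S m n) :
      Rel (castHom (add_zero m) (add_zero n) (f.tensor (id 0))) f
  | braid_natural {m n m' n'} (f : Term S m n) (g : Term S m' n') :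
      Rel ((f.tensor g).comp (braid n n')) ((braid m m').comp (g.tensor f))
  | braid_symm (m n) : Rel ((braid m n).comp (braid n m)) (id (m + n))
  | braid_zero (n) : Rel (castHom (zero_add n) (add_zero n) (braid 0 n)) (id n)
  | hexagon (m n p) :
      Rel (castHom (add_assoc m n p).symm (add_assoc n p m) (braid m (n + p)))
        ((castHom rfl (add_assoc n m p) ((braid m n).tensor (id p))).comp
          ((id n).tensor (braid m p)))

theorem mk_castHom {S : Signature.{u}} {m m' n n' : ℕ} (hm : m = m') (hn : n = n')
    (f : Term S m n) :
    Quot.mk Term.Rel (castHom hm hn f) =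
      castHom (H := fun m n => Quot (@Term.Rel S m n)) hm hn (Quot.mk Term.Rel f) := by
  subst hm hn; rfl

/-- The free prop on a signature. -/
def FreeProp (S : Signature.{u}) : PROP.{u} where
  Hom m n := Quot (@Term.Rel S m n)
  id n := Quot.mk _ (Term.id n)
  comp := Quot.map₂ Term.comp (fun _ _ _ h => .comp_congr (.refl _) h)
    (fun _ _ _ h => .comp_congr h (.refl _))
  tensor := Quot.map₂ Term.tensor (fun _ _ _ h => .tensor_congr (.refl _) h)
    (fun _ _ _ h => .tensor_congr h (.refl _))
  braid m n := Quot.mk _ (Term.braid m n)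
  id_comp := by rintro _ _ ⟨f⟩; exact Quot.sound (.id_comp f)
  comp_id := by rintro _ _ ⟨f⟩; exact Quot.sound (.comp_id f)
  assoc := by rintro _ _ _ _ ⟨f⟩ ⟨g⟩ ⟨h⟩; exact Quot.sound (.assoc f g h)
  tensor_id m n := Quot.sound (.tensor_id m n)
  tensor_comp := by
    rintro _ _ _ _ _ _ ⟨f⟩ ⟨g⟩ ⟨f'⟩ ⟨g'⟩; exact Quot.sound (.tensor_comp f g f' g')
  tensor_assoc := by
    rintro _ _ _ _ _ _ ⟨f⟩ ⟨g⟩ ⟨h⟩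
    exact (mk_castHom _ _ _).symm.trans (Quot.sound (.tensor_assoc f g h))
  id_zero_tensor := by
    rintro _ _ ⟨f⟩
    exact (mk_castHom _ _ _).symm.trans (Quot.sound (.id_zero_tensor f))
  tensor_id_zero := by
    rintro _ _ ⟨f⟩
    exact (mk_castHom _ _ _).symm.trans (Quot.sound (.tensor_id_zero f))
  braid_natural := by rintro _ _ _ _ ⟨f⟩ ⟨g⟩; exact Quot.sound (.braid_natural f g)
  braid_symm m n := Quot.sound (.braid_symm m n)
  braid_zero n := (mk_castHom _ _ _).symm.trans (Quot.sound (.braid_zero n))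
  hexagon m n p := by
    refine (mk_castHom _ _ _).symm.trans ((Quot.sound (.hexagon m n p)).trans ?_)
    exact congrArg (fun t => Quot.map₂ Term.comp (fun _ _ _ h => .comp_congr (.refl _) h)
      (fun _ _ _ h => .comp_congr h (.refl _)) t
        (Quot.mk _ ((Term.id n).tensor (Term.braid m p)))) (mk_castHom _ _ _)

/-- A generator, as a morphism of the free prop. -/
def FreeProp.of {S : Signature.{u}} {m n : ℕ} (s : S m n) : (FreeProp S).Hom m n :=
  Quot.mk _ (Term.gen s)

/-- The value of a formal expression in a prop, given the values of the generators. -/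
def Term.eval {S : Signature.{u}} (Q : PROP.{v}) (φ : ∀ {m n}, S m n → Q.Hom m n) :
    ∀ {m n}, Term S m n → Q.Hom m n
  | _, _, .gen s => φ s
  | _, _, .id n => Q.id n
  | _, _, .comp f g => Q.comp (f.eval Q φ) (g.eval Q φ)
  | _, _, .tensor f g => Q.tensor (f.eval Q φ) (g.eval Q φ)
  | _, _, .braid m n => Q.braid m n

theorem Term.eval_castHom {S : Signature.{u}} (Q : PROP.{v}) (φ : ∀ {m n}, S m n → Q.Hom m n)
    {m m' n n' : ℕ} (hm : m = m') (hn : n = n') (f : Term S m n) :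
    (castHom hm hn f).eval Q φ = castHom hm hn (f.eval Q φ) := by
  subst hm hn; rfl

theorem Term.Rel.eval_eq {S : Signature.{u}} (Q : PROP.{v}) (φ : ∀ {m n}, S m n → Q.Hom m n)
    {m n : ℕ} {f g : Term S m n} (h : Term.Rel f g) : f.eval Q φ = g.eval Q φ := by
  induction h with
  | refl => rfl
  | symm _ ih => exact ih.symm
  | trans _ _ ih ih' => exact ih.trans ih'
  | comp_congr _ _ ih ih' => simp only [Term.eval, ih, ih']
  | tensor_congr _ _ ih ih' => simp only [Term.eval, ih, ih']
  | id_comp f => exact Q.id_comp _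
  | comp_id f => exact Q.comp_id _
  | assoc f g h => exact Q.assoc _ _ _
  | tensor_id m n => exact Q.tensor_id m n
  | tensor_comp f g f' g' => exact Q.tensor_comp _ _ _ _
  | tensor_assoc f g h => rw [Term.eval_castHom]; exact Q.tensor_assoc _ _ _
  | id_zero_tensor f => rw [Term.eval_castHom]; exact Q.id_zero_tensor _
  | tensor_id_zero f => rw [Term.eval_castHom]; exact Q.tensor_id_zero _
  | braid_natural f g => exact Q.braid_natural _ _
  | braid_symm m n => exact Q.braid_symm m n
  | braid_zero n => rw [Term.eval_castHom]; exact Q.braid_zero n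
  | hexagon m n p =>
    rw [Term.eval_castHom]
    refine (Q.hexagon m n p).trans ?_
    simp only [Term.eval, Term.eval_castHom]

/-- The morphism of props out of a free prop with given values on the generators. -/
def FreeProp.lift {S : Signature.{u}} (Q : PROP.{v}) (φ : ∀ {m n}, S m n → Q.Hom m n) :
    PropHom (FreeProp S) Q where
  map := Quot.lift (Term.eval Q φ) fun _ _ h => h.eval_eq Q φ
  map_id _ := rfl
  map_comp := by rintro _ _ _ ⟨f⟩ ⟨g⟩; rfl
  map_tensor := by rintro _ _ _ _ ⟨f⟩ ⟨g⟩; rfl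
  map_braid _ _ := rfl

/-- The signature with generators `m : 2 ⟶ 1`, `i : 0 ⟶ 1`, `d : 1 ⟶ 2` and `e : 1 ⟶ 0`. -/
inductive FrobSig : ℕ → ℕ → Type
  | m : FrobSig 2 1
  | i : FrobSig 0 1
  | d : FrobSig 1 2
  | e : FrobSig 1 0

/-- The signature with one generator `1 ⟶ 1` for each element of `L`. -/
inductive LabelSig (L : Type u) : ℕ → ℕ → Type u
  | label (l : L) : LabelSig L 1 1

/-- The prop of circuit diagrams, free on `m`, `i`, `d`, `e` and the labels: it is the coproduct
of the free props on `FrobSig` and on `LabelSig L`. -/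
def FreeCirc (L : Type u) : PROP.{u} := FreeProp (Signature.sum FrobSig (LabelSig L))

end Free

section LinearRelations

theorem funext_sum {V : Type u} {m n : ℕ} {x y : Fin (m + n) → V}
    (h : ∀ i, x (Fin.castAdd n i) = y (Fin.castAdd n i))
    (h' : ∀ i, x (Fin.natAdd m i) = y (Fin.natAdd m i)) : x = y :=
  funext fun i => Fin.addCases (motive := fun i => x i = y i) h h' i

variable (k : Type u) [Field k] (V : Type u) [AddCommGroup V] [Module k V]

/-- A linear relation from `V ^ m` to `V ^ n`. -/
abbrev LinearRelation (m n : ℕ) : Type u := Submodule k ((Fin m → V) × (Fin n → V))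

variable {k V}

namespace LinearRelation

variable (k V) in
/-- The identity relation. -/
def id (n : ℕ) : LinearRelation k V n n where
  carrier := {p | p.1 = p.2}
  add_mem' {p q} hp hq := by
    simp only [Set.mem_ofPred_eq] at hp hq ⊢
    simp [hp, hq]
  zero_mem' := rfl
  smul_mem' c p hp := by
    simp only [Set.mem_ofPred_eq] at hp ⊢
    simp [hp]

/-- The composite of two relations: first `L`, then `M`. -/
def comp {l m n : ℕ} (L : LinearRelation k V l m) (M : LinearRelation k V m n) :
    LinearRelation k V l n where
  carrier := {p | ∃ y, (p.1, y) ∈ L ∧ (y, p.2) ∈ M}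
  add_mem' := by
    rintro p q ⟨y, h, h'⟩ ⟨z, g, g'⟩
    exact ⟨y + z, L.add_mem h g, M.add_mem h' g'⟩
  zero_mem' := ⟨0, L.zero_mem, M.zero_mem⟩
  smul_mem' := by
    rintro c p ⟨y, h, h'⟩
    exact ⟨c • y, L.smul_mem c h, M.smul_mem c h'⟩

/-- The direct sum of two relations. -/
def tensor {m n m' n' : ℕ} (L : LinearRelation k V m n) (M : LinearRelation k V m' n') :
    LinearRelation k V (m + m') (n + n') where
  carrier := {p | ((fun i => p.1 (Fin.castAdd m' i)), fun i => p.2 (Fin.castAdd n' i)) ∈ L ∧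
    ((fun i => p.1 (Fin.natAdd m i)), fun i => p.2 (Fin.natAdd n i)) ∈ M}
  add_mem' {_ _} h h' := ⟨L.add_mem h.1 h'.1, M.add_mem h.2 h'.2⟩
  zero_mem' := ⟨L.zero_mem, M.zero_mem⟩
  smul_mem' c _ h := ⟨L.smul_mem c h.1, M.smul_mem c h.2⟩

variable (k V) in
/-- The braiding: the graph of the map that exchanges `V ^ m` and `V ^ n`. -/
def braid (m n : ℕ) : LinearRelation k V (m + n) (n + m) where
  carrier := {p | (∀ i : Fin m, p.2 (Fin.natAdd n i) = p.1 (Fin.castAdd n i)) ∧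
    ∀ i : Fin n, p.2 (Fin.castAdd m i) = p.1 (Fin.natAdd m i)}
  add_mem' {_ _} h h' := ⟨fun i => by simp [h.1, h'.1], fun i => by simp [h.2, h'.2]⟩
  zero_mem' := ⟨fun _ => rfl, fun _ => rfl⟩
  smul_mem' c _ h := ⟨fun i => by simp [h.1], fun i => by simp [h.2]⟩

theorem mem_id {n : ℕ} {x y : Fin n → V} : (x, y) ∈ id k V n ↔ x = y := Iff.rfl

theorem mem_comp {l m n : ℕ} {L : LinearRelation k V l m} {M : LinearRelation k V m n}
    {x : Fin l → V} {z : Fin n → V} : (x, z) ∈ comp L M ↔ ∃ y, (x, y) ∈ L ∧ (y, z) ∈ M := Iff.rfl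

theorem mem_tensor {m n m' n' : ℕ} {L : LinearRelation k V m n} {M : LinearRelation k V m' n'}
    {x : Fin (m + m') → V} {y : Fin (n + n') → V} : (x, y) ∈ tensor L M ↔
    ((fun i => x (Fin.castAdd m' i)), fun i => y (Fin.castAdd n' i)) ∈ L ∧
    ((fun i => x (Fin.natAdd m i)), fun i => y (Fin.natAdd n i)) ∈ M := Iff.rfl

theorem mem_braid {m n : ℕ} {x : Fin (m + n) → V} {y : Fin (n + m) → V} :
    (x, y) ∈ braid k V m n ↔ (∀ i : Fin m, y (Fin.natAdd n i) = x (Fin.castAdd n i)) ∧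
    ∀ i : Fin n, y (Fin.castAdd m i) = x (Fin.natAdd m i) := Iff.rfl

theorem mem_castHom {m m' n n' : ℕ} (hm : m = m') (hn : n = n') (L : LinearRelation k V m n)
    {x : Fin m' → V} {y : Fin n' → V} :
    (x, y) ∈ (castHom (H := LinearRelation k V) hm hn L) ↔
      ((fun i => x (Fin.cast hm i)), fun i => y (Fin.cast hn i)) ∈ L := by
  subst hm hn; rfl

theorem ext' {m n : ℕ} {L M : LinearRelation k V m n}
    (h : ∀ x y, (x, y) ∈ L ↔ (x, y) ∈ M) : L = M :=
  Submodule.ext fun p => h p.1 p.2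

theorem forall_fin_add {m n : ℕ} {p : Fin (m + n) → Prop} :
    (∀ i, p i) ↔ (∀ i, p (Fin.castAdd n i)) ∧ ∀ i, p (Fin.natAdd m i) :=
  ⟨fun h => ⟨fun _ => h _, fun _ => h _⟩, fun h i => Fin.addCases h.1 h.2 i⟩

theorem cast_castAdd_castAdd {m n p : ℕ} (i : Fin m) :
    Fin.cast (add_assoc m n p) (Fin.castAdd p (Fin.castAdd n i)) = Fin.castAdd (n + p) i :=
  Fin.ext rfl

theorem cast_castAdd_natAdd {m n p : ℕ} (i : Fin n) :
    Fin.cast (add_assoc m n p) (Fin.castAdd p (Fin.natAdd m i)) =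
      Fin.natAdd m (Fin.castAdd p i) :=
  Fin.ext rfl

theorem cast_natAdd {m n p : ℕ} (i : Fin p) :
    Fin.cast (add_assoc m n p) (Fin.natAdd (m + n) i) = Fin.natAdd m (Fin.natAdd n i) :=
  Fin.ext (add_assoc m n i)

theorem cast_symm_castAdd {m n p : ℕ} {i : Fin m} :
    Fin.cast (add_assoc m n p).symm (Fin.castAdd (n + p) i) = Fin.castAdd p (Fin.castAdd n i) :=
  Fin.ext rfl

theorem cast_symm_natAdd_castAdd {m n p : ℕ} {i : Fin n} :
    Fin.cast (add_assoc m n p).symm (Fin.natAdd m (Fin.castAdd p i)) =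
      Fin.castAdd p (Fin.natAdd m i) :=
  Fin.ext rfl

theorem cast_symm_natAdd_natAdd {m n p : ℕ} {i : Fin p} :
    Fin.cast (add_assoc m n p).symm (Fin.natAdd m (Fin.natAdd n i)) = Fin.natAdd (m + n) i :=
  Fin.ext (add_assoc m n i).symm

theorem cast_zero_natAdd {n : ℕ} (i : Fin n) :
    Fin.cast (zero_add n) (Fin.natAdd 0 i) = i :=
  Fin.ext (zero_add _)

theorem cast_zero_castAdd {n : ℕ} (i : Fin n) :
    Fin.cast (add_zero n) (Fin.castAdd 0 i) = i := rfl

theorem cast_refl {n : ℕ} (i : Fin n) (h : n = n) : Fin.cast h i = i := rfl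

end LinearRelation

open LinearRelation in
variable (k V) in
/-- The prop of linear relations between the powers of `V`. -/
def LinRel : PROP.{u} where
  Hom := LinearRelation k V
  id := LinearRelation.id k V
  comp := LinearRelation.comp
  tensor := LinearRelation.tensor
  braid := LinearRelation.braid k V
  id_comp f := ext' fun x y => by simp [mem_comp, mem_id]
  comp_id f := ext' fun x y => by simp [mem_comp, mem_id]
  assoc f g h := ext' fun x y => by
    simp only [mem_comp]
    constructor
    · rintro ⟨z, ⟨w, h1, h2⟩, h3⟩; exact ⟨w, h1, z, h2, h3⟩
    · rintro ⟨w, h1, z, h2, h3⟩; exact ⟨z, ⟨w, h1, h2⟩, h3⟩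
  tensor_id m n := ext' fun x y => by
    simp only [mem_tensor, mem_id, funext_iff, forall_fin_add (m := m)]
  tensor_comp f g f' g' := ext' fun x y => by
    simp only [mem_tensor, mem_comp]
    constructor
    · rintro ⟨⟨u, h1, h2⟩, ⟨v, h3, h4⟩⟩
      exact ⟨Fin.append u v, by simpa using ⟨h1, h3⟩, by simpa using ⟨h2, h4⟩⟩
    · rintro ⟨w, ⟨h1, h2⟩, h3, h4⟩
      exact ⟨⟨_, h1, h3⟩, _, h2, h4⟩
  tensor_assoc f g h := ext' fun x y => by
    rw [mem_castHom]
    simp only [mem_tensor, cast_castAdd_castAdd, cast_castAdd_natAdd, cast_natAdd, and_assoc]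
  id_zero_tensor f := ext' fun x y => by
    rw [mem_castHom]
    simp only [mem_tensor, mem_id, cast_zero_natAdd]
    exact and_iff_right (Subsingleton.elim _ _)
  tensor_id_zero f := ext' fun x y => by
    rw [mem_castHom]
    simp only [mem_tensor, mem_id, cast_zero_castAdd]
    exact and_iff_left (Subsingleton.elim _ _)
  braid_natural {m n m' n'} f g := ext' fun x y => by
    simp only [mem_comp, mem_tensor, mem_braid]
    constructor
    · rintro ⟨z, ⟨h1, h2⟩, h3, h4⟩
      refine ⟨Fin.append (fun i => x (Fin.natAdd m i)) (fun i => x (Fin.castAdd m' i)), ?_, ?_⟩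
      · simp
      · simpa [h3, h4] using ⟨h2, h1⟩
    · rintro ⟨z, ⟨h1, h2⟩, h3, h4⟩
      refine ⟨Fin.append (fun i => y (Fin.natAdd n' i)) (fun i => y (Fin.castAdd n i)), ?_, ?_⟩
      · simp only [h1, h2] at h3 h4
        simpa using ⟨h4, h3⟩
      · simp
  braid_symm m n := ext' fun x y => by
    simp only [mem_comp, mem_braid, mem_id]
    constructor
    · rintro ⟨z, ⟨h1, h2⟩, h3, h4⟩
      exact funext_sum (fun i => by rw [h4, h1]) (fun i => by rw [h3, h2])
    · rintro rfl
      exact ⟨Fin.append (fun i => x (Fin.natAdd m i)) (fun i => x (Fin.castAdd n i)), by simp,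
        by simp⟩
  braid_zero n := ext' fun x y => by
    rw [mem_castHom]
    simp only [mem_braid, mem_id, cast_zero_natAdd, cast_zero_castAdd]
    constructor
    · rintro ⟨-, h⟩; exact funext fun i => (h i).symm
    · rintro rfl; exact ⟨fun i => i.elim0, fun _ => rfl⟩
  hexagon m n p := ext' fun x y => by
    rw [mem_castHom]
    simp only [mem_comp, mem_castHom, mem_tensor, mem_braid, mem_id, forall_fin_add (m := n),
      cast_symm_castAdd, cast_symm_natAdd_castAdd, cast_symm_natAdd_natAdd, cast_castAdd_castAdd,
      cast_castAdd_natAdd, cast_natAdd, cast_refl, funext_iff]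
    constructor
    · rintro ⟨h1, h2, h3⟩
      refine ⟨Fin.append (fun i => x (Fin.castAdd p (Fin.natAdd m i))) (Fin.append
        (fun i => x (Fin.castAdd p (Fin.castAdd n i))) (fun i => x (Fin.natAdd (m + n) i))),
        ⟨⟨?_, ?_⟩, ?_⟩, ?_, ?_, ?_⟩ <;> intro i <;> simp [h1, h2, h3]
    · rintro ⟨z, ⟨⟨h1, h2⟩, h3⟩, h4, h5, h6⟩
      exact ⟨fun i => by rw [h5, h1], fun i => by rw [← h4, h2], fun i => by rw [h6, h3]⟩

variable (k) in
/-- The prop of linear relations between the spaces `k ^ n`. -/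
def FinRel : PROP.{u} := LinRel k k

end LinearRelations

section LagrangianRelations

variable {k : Type u} [Field k]

/-- A subspace is isotropic for a form if the form vanishes on it. -/
def IsIsotropic {W : Type u} [AddCommGroup W] [Module k W] (ω : LinearMap.BilinForm k W)
    (L : Submodule k W) : Prop :=
  ∀ v ∈ L, ∀ w ∈ L, ω v w = 0

/-- A subspace is Lagrangian if it is isotropic and not properly contained in any other isotropic
subspace. -/
def IsLagrangian {W : Type u} [AddCommGroup W] [Module k W] (ω : LinearMap.BilinForm k W)
    (L : Submodule k W) : Prop :=
  IsIsotropic ω L ∧ ∀ M, IsIsotropic ω M → L ≤ M → M = L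

theorem isLagrangian_iff {W : Type u} [AddCommGroup W] [Module k W]
    {ω : LinearMap.BilinForm k W} (hω : ∀ v, ω v v = 0) (L : Submodule k W) :
    IsLagrangian ω L ↔ ∀ v, v ∈ L ↔ ∀ w ∈ L, ω v w = 0 := by
  have hanti : ∀ v w, ω v w = - ω w v := fun v w => by
    have := hω (v + w)
    simp only [map_add, LinearMap.add_apply, hω, zero_add, add_zero] at this
    exact eq_neg_of_add_eq_zero_right this
  constructor
  · rintro ⟨h, h'⟩ v
    refine ⟨fun hv w hw => h v hv w hw, fun hv => ?_⟩
    have : L ⊔ Submodule.span k {v} = L := by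
      refine h' _ ?_ le_sup_left
      intro a ha b hb
      obtain ⟨a, haL, c, hc, rfl⟩ := Submodule.mem_sup.1 ha
      obtain ⟨b, hbL, d, hd, rfl⟩ := Submodule.mem_sup.1 hb
      obtain ⟨c, rfl⟩ := Submodule.mem_span_singleton.1 hc
      obtain ⟨d, rfl⟩ := Submodule.mem_span_singleton.1 hd
      simp [h a haL b hbL, hω, hv b hbL, hanti a v, hv a haL]
    rw [← this]
    exact Submodule.mem_sup_right (Submodule.mem_span_singleton_self v)
  · intro h
    refine ⟨fun v hv w hw => (h v).1 hv w hw, fun M hM hLM => le_antisymm (fun v hv => ?_) hLM⟩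
    exact (h v).2 fun w hw => hM v hv w (hLM hw)

variable (k) in
/-- The standard symplectic form on `(k ⊕ k) ^ n`, the direct sum of `n` copies of the form
`((φ, I), (φ', I')) ↦ φ I' - φ' I`. -/
def sympForm (n : ℕ) : LinearMap.BilinForm k (Fin n → k × k) :=
  LinearMap.mk₂ k (fun x y => ∑ j, ((x j).1 * (y j).2 - (y j).1 * (x j).2))
    (fun x x' y => by
      rw [← Finset.sum_add_distrib]; exact Finset.sum_congr rfl fun j _ => by simp; ring)
    (fun c x y => by
      rw [Finset.smul_sum]; exact Finset.sum_congr rfl fun j _ => by simp; ring)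
    (fun x y y' => by
      rw [← Finset.sum_add_distrib]; exact Finset.sum_congr rfl fun j _ => by simp; ring)
    (fun c x y => by
      rw [Finset.smul_sum]; exact Finset.sum_congr rfl fun j _ => by simp; ring)

variable (k) in
/-- The symplectic form on the direct sum of the conjugate of `(k ⊕ k) ^ m` and `(k ⊕ k) ^ n`. -/
def relForm (m n : ℕ) : LinearMap.BilinForm k ((Fin m → k × k) × (Fin n → k × k)) :=
  -(sympForm k m).compl₁₂ (LinearMap.fst k _ _) (LinearMap.fst k _ _) +
    (sympForm k n).compl₁₂ (LinearMap.snd k _ _) (LinearMap.snd k _ _)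

/-- A linear Lagrangian relation from `(k ⊕ k) ^ m` to `(k ⊕ k) ^ n`. -/
def IsLagrangianRelation {m n : ℕ} (L : LinearRelation k (k × k) m n) : Prop :=
  IsLagrangian (relForm k m n) L

theorem sympForm_apply {n : ℕ} (x y : Fin n → k × k) :
    sympForm k n x y = ∑ j, ((x j).1 * (y j).2 - (y j).1 * (x j).2) := rfl

theorem relForm_apply {m n : ℕ} (p q : (Fin m → k × k) × (Fin n → k × k)) :
    relForm k m n p q = -sympForm k m p.1 q.1 + sympForm k n p.2 q.2 := rfl

theorem sympForm_self {n : ℕ} (x : Fin n → k × k) : sympForm k n x x = 0 := by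
  simp [sympForm_apply]

theorem sympForm_anti {n : ℕ} (x y : Fin n → k × k) :
    sympForm k n x y = -sympForm k n y x := by
  simp only [sympForm_apply, ← Finset.sum_neg_distrib, neg_sub]

theorem sympForm_single_left {n : ℕ} (j : Fin n) (v : k × k) (y : Fin n → k × k) :
    sympForm k n (Pi.single j v) y = v.1 * (y j).2 - (y j).1 * v.2 := by
  rw [sympForm_apply, Finset.sum_eq_single j]
  · simp
  · intro i _ hi; simp [Pi.single_eq_of_ne hi]
  · simp

theorem sympForm_add {m n : ℕ} (x y : Fin (m + n) → k × k) :
    sympForm k (m + n) x y =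
      sympForm k m (fun i => x (Fin.castAdd n i)) (fun i => y (Fin.castAdd n i)) +
      sympForm k n (fun i => x (Fin.natAdd m i)) (fun i => y (Fin.natAdd m i)) := by
  simp only [sympForm_apply, Fin.sum_univ_add]

/-- Every linear functional on `(k ⊕ k) ^ n` is represented by the symplectic form. -/
theorem exists_sympForm {n : ℕ} (f : (Fin n → k × k) →ₗ[k] k) :
    ∃ b, ∀ x, f x = sympForm k n x b := by
  refine ⟨fun j => (-f (Pi.single j (0, 1)), f (Pi.single j (1, 0))), fun x => ?_⟩
  suffices h : f = (sympForm k n).flip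
      (fun j => (-f (Pi.single j (0, 1)), f (Pi.single j (1, 0)))) by
    conv_lhs => rw [h]
    rfl
  refine LinearMap.pi_ext fun j v => ?_
  refine Eq.trans ?_ (sympForm_single_left j v _).symm
  have : (Pi.single j v : Fin n → k × k) =
      v.1 • (Pi.single j (1, 0) : Fin n → k × k) + v.2 • (Pi.single j (0, 1) : Fin n → k × k) := by
    rw [← Pi.single_smul, ← Pi.single_smul, ← Pi.single_add]; simp
  rw [this, map_add, map_smul, map_smul, smul_eq_mul, smul_eq_mul]
  ring

theorem sympForm_eq_zero {n : ℕ} {b : Fin n → k × k} (h : ∀ x, sympForm k n x b = 0) : b = 0 := by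
  funext j
  have h1 := h (Pi.single j (1, 0))
  have h2 := h (Pi.single j (0, 1))
  rw [sympForm_single_left] at h1 h2
  ext
  · simpa using h2
  · simpa using h1

theorem isLagrangianRelation_iff {m n : ℕ} (L : LinearRelation k (k × k) m n) :
    IsLagrangianRelation L ↔
      ∀ x y, (x, y) ∈ L ↔ ∀ x' y', (x', y') ∈ L → sympForm k m x x' = sympForm k n y y' := by
  rw [IsLagrangianRelation, isLagrangian_iff fun v => by simp [relForm_apply, sympForm_self]]
  simp only [Prod.forall, relForm_apply, neg_add_eq_zero]

theorem isLagrangianRelation_id (n : ℕ) :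
    IsLagrangianRelation (LinearRelation.id k (k × k) n) := by
  rw [isLagrangianRelation_iff]
  intro x y
  simp only [LinearRelation.mem_id]
  constructor
  · rintro rfl x' _ rfl; rfl
  · intro h
    have : ∀ z, sympForm k n z (x - y) = 0 := fun z => by
      have hz := h z z rfl
      rw [map_sub, sympForm_anti, sympForm_anti z y, hz, sub_self]
    exact sub_eq_zero.1 (sympForm_eq_zero this)

theorem isLagrangianRelation_comp {l m n : ℕ} {L : LinearRelation k (k × k) l m}
    {M : LinearRelation k (k × k) m n} (hL : IsLagrangianRelation L)
    (hM : IsLagrangianRelation M) : IsLagrangianRelation (L.comp M) := by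
  rw [isLagrangianRelation_iff] at *
  intro v u
  constructor
  · rintro ⟨w, h1, h2⟩ v' u' ⟨w', h1', h2'⟩
    rw [(hL v w).1 h1 v' w' h1', (hM w u).1 h2 w' u' h2']
  · intro h
    by_contra hcon
    let D : Submodule k (((Fin l → k × k) × (Fin m → k × k)) ×
        ((Fin m → k × k) × (Fin n → k × k))) :=
      { carrier := {p | p.1.1 = 0 ∧ p.1.2 = p.2.1 ∧ p.2.2 = 0}
        add_mem' := by
          rintro p q ⟨h1, h2, h3⟩ ⟨h1', h2', h3'⟩
          exact ⟨by simp [h1, h1'], by simp [h2, h2'], by simp [h3, h3']⟩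
        zero_mem' := ⟨rfl, rfl, rfl⟩
        smul_mem' := by
          rintro c p ⟨h1, h2, h3⟩
          exact ⟨by simp [h1], by simp [h2], by simp [h3]⟩ }
    have hnot : (((v, 0), (0, u)) : ((Fin l → k × k) × (Fin m → k × k)) ×
        ((Fin m → k × k) × (Fin n → k × k))) ∉ L.prod M ⊔ D := by
      intro hmem
      obtain ⟨⟨⟨a, b⟩, ⟨c, d⟩⟩, hab, ⟨⟨a', w⟩, ⟨w', d'⟩⟩, ⟨ha', hw, hd'⟩, heq⟩ :=
        Submodule.mem_sup.1 hmem
      simp only at ha' hw hd'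
      subst ha' hw hd'
      simp only [Prod.mk_add_mk, add_zero, Prod.mk.injEq] at heq
      obtain ⟨⟨rfl, h1⟩, h2, rfl⟩ := heq
      have hbc : b = c := by
        rw [eq_neg_of_add_eq_zero_left h1, eq_neg_of_add_eq_zero_left h2]
      subst hbc
      exact hcon ⟨b, hab.1, hab.2⟩
    obtain ⟨f, hf, hfD⟩ := Submodule.exists_le_ker_of_notMem hnot
    obtain ⟨a, ha⟩ := exists_sympForm
      (f ∘ₗ LinearMap.inl k _ _ ∘ₗ LinearMap.inl k (Fin l → k × k) (Fin m → k × k))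
    obtain ⟨b, hb⟩ := exists_sympForm
      (f ∘ₗ LinearMap.inl k _ _ ∘ₗ LinearMap.inr k (Fin l → k × k) (Fin m → k × k))
    obtain ⟨c, hc⟩ := exists_sympForm
      (f ∘ₗ LinearMap.inr k _ _ ∘ₗ LinearMap.inl k (Fin m → k × k) (Fin n → k × k))
    obtain ⟨d, hd⟩ := exists_sympForm
      (f ∘ₗ LinearMap.inr k _ _ ∘ₗ LinearMap.inr k (Fin m → k × k) (Fin n → k × k))
    have hfall : ∀ x y z t, f ((x, y), (z, t)) =
        sympForm k l x a + sympForm k m y b + (sympForm k m z c + sympForm k n t d) := by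
      intro x y z t
      rw [← ha, ← hb, ← hc, ← hd]
      simp only [LinearMap.comp_apply, LinearMap.inl_apply, LinearMap.inr_apply, ← map_add]
      simp
    have hbc : b = -c := by
      rw [eq_neg_iff_add_eq_zero]
      refine sympForm_eq_zero fun w => ?_
      have := hfD (Submodule.mem_sup_right (show ((0, w), (w, 0)) ∈ D from ⟨rfl, rfl, rfl⟩))
      rw [LinearMap.mem_ker, hfall] at this
      simpa using this
    have h1 : (-a, b) ∈ L := by
      rw [hL]
      intro x y hxy
      have := hfD (Submodule.mem_sup_left (show ((x, y), (0, 0)) ∈ L.prod M from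
        ⟨hxy, M.zero_mem⟩))
      rw [LinearMap.mem_ker, hfall] at this
      simp only [map_zero, LinearMap.zero_apply, add_zero] at this
      rw [sympForm_anti, sympForm_anti b, map_neg, neg_neg]
      exact eq_neg_of_add_eq_zero_left this
    have h2 : (b, d) ∈ M := by
      rw [hM]
      intro x y hxy
      have := hfD (Submodule.mem_sup_left (show ((0, 0), (x, y)) ∈ L.prod M from
        ⟨L.zero_mem, hxy⟩))
      rw [LinearMap.mem_ker, hfall] at this
      simp only [map_zero, LinearMap.zero_apply, zero_add] at this
      rw [hbc, sympForm_anti, sympForm_anti d, map_neg, neg_neg]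
      exact eq_neg_of_add_eq_zero_left this
    have h3 := h (-a) d ⟨b, h1, h2⟩
    apply hf
    rw [hfall, ← h3]
    simp

theorem isLagrangianRelation_tensor {m n m' n' : ℕ} {L : LinearRelation k (k × k) m n}
    {M : LinearRelation k (k × k) m' n'} (hL : IsLagrangianRelation L)
    (hM : IsLagrangianRelation M) : IsLagrangianRelation (L.tensor M) := by
  rw [isLagrangianRelation_iff] at *
  intro x y
  rw [LinearRelation.mem_tensor]
  simp only [sympForm_add]
  constructor
  · rintro ⟨h1, h2⟩ x' y' ⟨h3, h4⟩
    rw [(hL _ _).1 h1 _ _ h3, (hM _ _).1 h2 _ _ h4]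
  · intro h
    rw [hL, hM]
    constructor
    · intro x' y' h'
      have := h (Fin.append x' 0) (Fin.append y' 0) (by
        rw [LinearRelation.mem_tensor]
        simp only [Fin.append_left, Fin.append_right]
        exact ⟨h', M.zero_mem⟩)
      simp only [Fin.append_left, Fin.append_right] at this
      simpa [sympForm_apply] using this
    · intro x' y' h'
      have := h (Fin.append 0 x') (Fin.append 0 y') (by
        rw [LinearRelation.mem_tensor]
        simp only [Fin.append_left, Fin.append_right]
        exact ⟨L.zero_mem, h'⟩)
      simp only [Fin.append_left, Fin.append_right] at this
      simpa [sympForm_apply] using this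

theorem isLagrangianRelation_braid (m n : ℕ) :
    IsLagrangianRelation (LinearRelation.braid k (k × k) m n) := by
  rw [isLagrangianRelation_iff]
  intro x y
  constructor
  · rintro ⟨h1, h2⟩ x' y' ⟨h1', h2'⟩
    dsimp only at h1 h2 h1' h2'
    rw [sympForm_add, sympForm_add, add_comm]
    simp only [h1, h2, h1', h2']
  · intro h
    let z : Fin (n + m) → k × k :=
      Fin.append (fun i => x (Fin.natAdd m i)) (fun i => x (Fin.castAdd n i))
    have hz : y = z := by
      refine sub_eq_zero.1 (sympForm_eq_zero fun y' => ?_)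
      have := h (Fin.append (fun i => y' (Fin.natAdd n i)) (fun i => y' (Fin.castAdd m i))) y'
        (by simp [LinearRelation.mem_braid])
      rw [sympForm_add] at this
      simp only [Fin.append_left, Fin.append_right] at this
      rw [map_sub, sympForm_anti, ← this, sympForm_anti y' z, sympForm_add z]
      simp only [z, Fin.append_left, Fin.append_right]
      ring
    subst hz
    simp [LinearRelation.mem_braid, z]

theorem coe_castHom {m m' n n' : ℕ} (hm : m = m') (hn : n = n')
    (L : {L : LinearRelation k (k × k) m n // IsLagrangianRelation L}) :
    (castHom (H := fun m n => {L : LinearRelation k (k × k) m n // IsLagrangianRelation L})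
      hm hn L).1 = castHom (H := LinearRelation k (k × k)) hm hn L.1 := by
  subst hm hn; rfl

variable (k) in
/-- The prop of linear Lagrangian relations between the symplectic spaces `(k ⊕ k) ^ n`. -/
def LagRel : PROP.{u} where
  Hom m n := {L : LinearRelation k (k × k) m n // IsLagrangianRelation L}
  id n := ⟨_, isLagrangianRelation_id n⟩
  comp L M := ⟨_, isLagrangianRelation_comp L.2 M.2⟩
  tensor L M := ⟨_, isLagrangianRelation_tensor L.2 M.2⟩
  braid m n := ⟨_, isLagrangianRelation_braid m n⟩
  id_comp f := Subtype.ext ((LinRel k (k × k)).id_comp f.1)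
  comp_id f := Subtype.ext ((LinRel k (k × k)).comp_id f.1)
  assoc f g h := Subtype.ext ((LinRel k (k × k)).assoc f.1 g.1 h.1)
  tensor_id m n := Subtype.ext ((LinRel k (k × k)).tensor_id m n)
  tensor_comp f g f' g' := Subtype.ext ((LinRel k (k × k)).tensor_comp f.1 g.1 f'.1 g'.1)
  tensor_assoc f g h := Subtype.ext
    ((coe_castHom _ _ _).trans ((LinRel k (k × k)).tensor_assoc f.1 g.1 h.1))
  id_zero_tensor f := Subtype.ext
    ((coe_castHom _ _ _).trans ((LinRel k (k × k)).id_zero_tensor f.1))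
  tensor_id_zero f := Subtype.ext
    ((coe_castHom _ _ _).trans ((LinRel k (k × k)).tensor_id_zero f.1))
  braid_natural f g := Subtype.ext ((LinRel k (k × k)).braid_natural f.1 g.1)
  braid_symm m n := Subtype.ext ((LinRel k (k × k)).braid_symm m n)
  braid_zero n := Subtype.ext ((coe_castHom _ _ _).trans ((LinRel k (k × k)).braid_zero n))
  hexagon m n p := Subtype.ext ((coe_castHom _ _ _).trans
    (((LinRel k (k × k)).hexagon m n p).trans
      (congrArg (fun L => LinearRelation.comp L _)
        (coe_castHom (m := m + n + p) (n := n + m + p) rfl (add_assoc n m p)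
          ⟨_, isLagrangianRelation_tensor (isLagrangianRelation_braid m n)
            (isLagrangianRelation_id p)⟩).symm)))

/-- The vector in `(k ⊕ k) ^ n` with entries `((x 0, x 1), (x 2, x 3), …)`. -/
def pairUp {k : Type u} {n : ℕ} (x : Fin (2 * n) → k) : Fin n → k × k :=
  fun j => (x ⟨2 * j, by omega⟩, x ⟨2 * j + 1, by omega⟩)

theorem pairUp_bijective {k : Type u} (n : ℕ) : Function.Bijective (pairUp (k := k) (n := n)) := by
  constructor
  · intro x y h
    funext i
    have hi := congrFun h ⟨i / 2, by omega⟩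
    simp only [pairUp, Prod.mk.injEq] at hi
    rcases Nat.mod_two_eq_zero_or_one i with h0 | h1
    · have : i = ⟨2 * (i / 2), by omega⟩ := Fin.ext (by dsimp only; omega)
      rw [this]; exact hi.1
    · have : i = ⟨2 * (i / 2) + 1, by omega⟩ := Fin.ext (by dsimp only; omega)
      rw [this]; exact hi.2
  · intro z
    refine ⟨fun i => if (i : ℕ) % 2 = 0 then (z ⟨i / 2, by omega⟩).1 else (z ⟨i / 2, by omega⟩).2,
      funext fun j => ?_⟩
    have h1 : (2 * (j : ℕ) + 1) / 2 = j := by omega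
    simp [pairUp, Nat.add_mod, h1]

/-- A relation from `(k ⊕ k) ^ m` to `(k ⊕ k) ^ n`, seen as a relation from `k ^ (2 m)` to
`k ^ (2 n)`. -/
def flattenRelation {m n : ℕ} (L : LinearRelation k (k × k) m n) :
    LinearRelation k k (2 * m) (2 * n) where
  carrier := {p | (pairUp p.1, pairUp p.2) ∈ L}
  add_mem' {_ _} h h' := L.add_mem h h'
  zero_mem' := L.zero_mem
  smul_mem' c _ h := L.smul_mem c h

theorem mem_flattenRelation {m n : ℕ} {L : LinearRelation k (k × k) m n}
    {x : Fin (2 * m) → k} {y : Fin (2 * n) → k} :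
    (x, y) ∈ flattenRelation L ↔ (pairUp x, pairUp y) ∈ L := Iff.rfl

theorem pairUp_castAdd {k : Type u} {m n : ℕ} (x : Fin (2 * (m + n)) → k) :
    pairUp (fun i : Fin (2 * m) => x (Fin.cast (Nat.mul_add 2 m n).symm (Fin.castAdd (2 * n) i))) =
      fun i => pairUp x (Fin.castAdd n i) := rfl

theorem pairUp_natAdd {k : Type u} {m n : ℕ} (x : Fin (2 * (m + n)) → k) :
    pairUp (fun i : Fin (2 * n) => x (Fin.cast (Nat.mul_add 2 m n).symm (Fin.natAdd (2 * m) i))) =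
      fun i => pairUp x (Fin.natAdd m i) := by
  funext j
  refine Prod.ext (congrArg x (Fin.ext ?_)) (congrArg x (Fin.ext ?_)) <;> simp <;> ring

theorem castHom_flattenRelation_tensor {m n m' n' : ℕ} (L : LinearRelation k (k × k) m n)
    (M : LinearRelation k (k × k) m' n') :
    castHom (H := LinearRelation k k) (Nat.mul_add 2 m m') (Nat.mul_add 2 n n')
      (flattenRelation (L.tensor M)) = (flattenRelation L).tensor (flattenRelation M) := by
  refine LinearRelation.ext' fun x y => ?_
  obtain ⟨x, rfl⟩ : ∃ x' : Fin (2 * (m + m')) → k,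
      x = fun i => x' (Fin.cast (Nat.mul_add 2 m m').symm i) :=
    ⟨fun i => x (Fin.cast (Nat.mul_add 2 m m') i), rfl⟩
  obtain ⟨y, rfl⟩ : ∃ y' : Fin (2 * (n + n')) → k,
      y = fun i => y' (Fin.cast (Nat.mul_add 2 n n').symm i) :=
    ⟨fun i => y (Fin.cast (Nat.mul_add 2 n n') i), rfl⟩
  rw [LinearRelation.mem_castHom, LinearRelation.mem_tensor]
  simp only [mem_flattenRelation]
  rw [pairUp_castAdd, pairUp_castAdd, pairUp_natAdd, pairUp_natAdd]
  exact LinearRelation.mem_tensor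

theorem castHom_flattenRelation_braid (m n : ℕ) :
    castHom (H := LinearRelation k k) (Nat.mul_add 2 m n) (Nat.mul_add 2 n m)
      (flattenRelation (LinearRelation.braid k (k × k) m n)) =
        LinearRelation.braid k k (2 * m) (2 * n) := by
  refine LinearRelation.ext' fun x y => ?_
  obtain ⟨x, rfl⟩ : ∃ x' : Fin (2 * (m + n)) → k,
      x = fun i => x' (Fin.cast (Nat.mul_add 2 m n).symm i) :=
    ⟨fun i => x (Fin.cast (Nat.mul_add 2 m n) i), rfl⟩
  obtain ⟨y, rfl⟩ : ∃ y' : Fin (2 * (n + m)) → k,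
      y = fun i => y' (Fin.cast (Nat.mul_add 2 n m).symm i) :=
    ⟨fun i => y (Fin.cast (Nat.mul_add 2 n m) i), rfl⟩
  rw [LinearRelation.mem_castHom, LinearRelation.mem_braid, ← funext_iff, ← funext_iff,
    ← (pairUp_bijective m).1.eq_iff, ← (pairUp_bijective n).1.eq_iff, pairUp_castAdd,
    pairUp_castAdd, pairUp_natAdd, pairUp_natAdd, funext_iff, funext_iff]
  exact LinearRelation.mem_braid (k := k)

variable (k) in
/-- The inclusion of Lagrangian relations in linear relations; it sends the object `n`, which
stands for `(k ⊕ k) ^ n`, to the object `2 n`, which stands for `k ^ (2 n)`. -/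
def LagRel.inclusion : StrictFunctor (LagRel k) (FinRel k) where
  obj n := 2 * n
  map L := flattenRelation L.1
  obj_zero := rfl
  obj_add m n := Nat.mul_add 2 m n
  map_id n := LinearRelation.ext' fun x y => (pairUp_bijective n).1.eq_iff
  map_comp {l m n} L M := LinearRelation.ext' fun x z => by
    constructor
    · rintro ⟨w, h1, h2⟩
      obtain ⟨y, rfl⟩ := (pairUp_bijective m).2 w
      exact ⟨y, h1, h2⟩
    · rintro ⟨y, h1, h2⟩
      exact ⟨pairUp y, h1, h2⟩
  map_tensor L M := castHom_flattenRelation_tensor L.1 M.1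
  map_braid m n := castHom_flattenRelation_braid m n

end LagrangianRelations

section Circuits

/-- An `L`-circuit from `m` to `n`: a finite directed graph with edges labelled by `L`, together
with a cospan of finite sets from `Fin m` to `Fin n` whose apex is the set of nodes. -/
structure Circuit (L : Type u) (m n : ℕ) where
  Node : Type
  Edge : Type
  [finite_node : Finite Node]
  [finite_edge : Finite Edge]
  inp : Fin m → Node
  out : Fin n → Node
  src : Edge → Node
  tgt : Edge → Node
  label : Edge → L

attribute [instance] Circuit.finite_node Circuit.finite_edge

namespace Circuit

variable {L : Type u}

/-- An isomorphism of circuits: bijections of nodes and edges that preserve all the structure. -/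
structure Iso {m n : ℕ} (a b : Circuit L m n) where
  node : a.Node ≃ b.Node
  edge : a.Edge ≃ b.Edge
  inp : ∀ x, node (a.inp x) = b.inp x
  out : ∀ y, node (a.out y) = b.out y
  src : ∀ e, node (a.src e) = b.src (edge e)
  tgt : ∀ e, node (a.tgt e) = b.tgt (edge e)
  label : ∀ e, a.label e = b.label (edge e)

/-- Circuits up to isomorphism. -/
instance setoid (L : Type u) (m n : ℕ) : Setoid (Circuit L m n) where
  r a b := Nonempty (Iso a b)
  iseqv :=
    { refl := fun a => ⟨⟨.refl _, .refl _, fun _ => rfl, fun _ => rfl, fun _ => rfl, fun _ => rfl,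
        fun _ => rfl⟩⟩
      symm := fun ⟨f⟩ => ⟨⟨f.node.symm, f.edge.symm,
        fun x => by rw [← f.inp, Equiv.symm_apply_apply],
        fun x => by rw [← f.out, Equiv.symm_apply_apply],
        fun e => by rw [Equiv.symm_apply_eq, f.src, Equiv.apply_symm_apply],
        fun e => by rw [Equiv.symm_apply_eq, f.tgt, Equiv.apply_symm_apply],
        fun e => by rw [f.label, Equiv.apply_symm_apply]⟩⟩
      trans := fun ⟨f⟩ ⟨g⟩ => ⟨⟨f.node.trans g.node, f.edge.trans g.edge,
        fun x => by simp [f.inp, g.inp], fun x => by simp [f.out, g.out],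
        fun e => by simp [f.src, g.src], fun e => by simp [f.tgt, g.tgt],
        fun e => by rw [f.label, g.label]; rfl⟩⟩ }

/-- The circuit without edges given by a cospan of finite sets. -/
def ofCospan {m n : ℕ} {N : Type} [Finite N] (i : Fin m → N) (o : Fin n → N) : Circuit L m n where
  Node := N
  Edge := Empty
  inp := i
  out := o
  src := Empty.elim
  tgt := Empty.elim
  label := Empty.elim

/-- The circuit with a single edge, labelled by `l`, from its input node to its output node. -/
def ofLabel (l : L) : Circuit L 1 1 where
  Node := Fin 2
  Edge := Unit
  inp _ := 0
  out _ := 1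
  src _ := 0
  tgt _ := 1
  label _ := l

/-- The relation on the disjoint union of the nodes of two composable circuits that glues each
output of the first to the corresponding input of the second. -/
def Glue {l m n : ℕ} (a : Circuit L l m) (b : Circuit L m n) (p q : a.Node ⊕ b.Node) : Prop :=
  ∃ y, p = .inl (a.out y) ∧ q = .inr (b.inp y)

/-- The composite of two circuits: first `a`, then `b`.  Its set of nodes is the pushout of the
sets of nodes over `Fin m`. -/
def comp {l m n : ℕ} (a : Circuit L l m) (b : Circuit L m n) : Circuit L l n where
  Node := Quot (Glue a b)
  Edge := a.Edge ⊕ b.Edge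
  inp x := Quot.mk _ (.inl (a.inp x))
  out y := Quot.mk _ (.inr (b.out y))
  src := Sum.elim (fun e => Quot.mk _ (.inl (a.src e))) fun e => Quot.mk _ (.inr (b.src e))
  tgt := Sum.elim (fun e => Quot.mk _ (.inl (a.tgt e))) fun e => Quot.mk _ (.inr (b.tgt e))
  label := Sum.elim a.label b.label

/-- The tensor product of two circuits: their disjoint union. -/
def tensor {m n m' n' : ℕ} (a : Circuit L m n) (b : Circuit L m' n') :
    Circuit L (m + m') (n + n') where
  Node := a.Node ⊕ b.Node
  Edge := a.Edge ⊕ b.Edge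
  inp := Fin.addCases (fun x => .inl (a.inp x)) fun x => .inr (b.inp x)
  out := Fin.addCases (fun y => .inl (a.out y)) fun y => .inr (b.out y)
  src := Sum.map a.src b.src
  tgt := Sum.map a.tgt b.tgt
  label := Sum.elim a.label b.label

/-- Relabelling of the inputs and the outputs of a circuit. -/
def reindex {m n m' n' : ℕ} (a : Circuit L m n) (i : Fin m' → Fin m) (o : Fin n' → Fin n) :
    Circuit L m' n' where
  Node := a.Node
  Edge := a.Edge
  inp x := a.inp (i x)
  out y := a.out (o y)
  src := a.src
  tgt := a.tgt
  label := a.label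

/-- The identity circuit. -/
def id (L : Type u) (n : ℕ) : Circuit L n n :=
  ofCospan (fun i => i) fun i => i

/-- The function that exchanges the two summands of `Fin (m + n)`. -/
def swap (m n : ℕ) : Fin (m + n) → Fin (n + m) :=
  Fin.addCases (Fin.natAdd n) (Fin.castAdd m)

/-- The circuit without edges that exchanges `m` wires with `n` wires. -/
def braid (L : Type u) (m n : ℕ) : Circuit L (m + n) (n + m) :=
  ofCospan (swap m n) fun i => i

theorem tensor_inp_left {m n m' n' : ℕ} (a : Circuit L m n) (b : Circuit L m' n') (i : Fin m) :
    (tensor a b).inp (Fin.castAdd m' i) = Sum.inl (a.inp i) := by simp [tensor]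

theorem tensor_inp_right {m n m' n' : ℕ} (a : Circuit L m n) (b : Circuit L m' n') (i : Fin m') :
    (tensor a b).inp (Fin.natAdd m i) = Sum.inr (b.inp i) := by simp [tensor]

theorem tensor_out_left {m n m' n' : ℕ} (a : Circuit L m n) (b : Circuit L m' n') (i : Fin n) :
    (tensor a b).out (Fin.castAdd n' i) = Sum.inl (a.out i) := by simp [tensor]

theorem tensor_out_right {m n m' n' : ℕ} (a : Circuit L m n) (b : Circuit L m' n') (i : Fin n') :
    (tensor a b).out (Fin.natAdd n i) = Sum.inr (b.out i) := by simp [tensor]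

theorem swap_castAdd {m n : ℕ} (i : Fin m) : swap m n (Fin.castAdd n i) = Fin.natAdd n i :=
  Fin.addCases_left i

theorem swap_natAdd {m n : ℕ} (i : Fin n) : swap m n (Fin.natAdd m i) = Fin.castAdd m i :=
  Fin.addCases_right i

theorem comp_sound {l m n : ℕ} {a a' : Circuit L l m} {b b' : Circuit L m n} (f : Iso a a')
    (g : Iso b b') : comp a b ≈ comp a' b' := by
  refine ⟨⟨Quot.congr (Equiv.sumCongr f.node g.node) ?_, Equiv.sumCongr f.edge g.edge,
    fun x => ?_, fun x => ?_, ?_, ?_, ?_⟩⟩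
  · intro p q
    refine exists_congr fun y => ?_
    rw [← f.out, ← g.inp]
    rcases p with p | p <;> rcases q with q | q <;> simp
  · exact congrArg (fun t => Quot.mk _ (Sum.inl t)) (f.inp x)
  · exact congrArg (fun t => Quot.mk _ (Sum.inr t)) (g.out x)
  · rintro (e | e)
    · exact congrArg (fun t => Quot.mk _ (Sum.inl t)) (f.src e)
    · exact congrArg (fun t => Quot.mk _ (Sum.inr t)) (g.src e)
  · rintro (e | e)
    · exact congrArg (fun t => Quot.mk _ (Sum.inl t)) (f.tgt e)
    · exact congrArg (fun t => Quot.mk _ (Sum.inr t)) (g.tgt e)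
  · rintro (e | e)
    · exact f.label e
    · exact g.label e

theorem tensor_sound {m n m' n' : ℕ} {a a' : Circuit L m n} {b b' : Circuit L m' n'}
    (f : Iso a a') (g : Iso b b') : tensor a b ≈ tensor a' b' := by
  refine ⟨⟨Equiv.sumCongr f.node g.node, Equiv.sumCongr f.edge g.edge, ?_, ?_, ?_, ?_, ?_⟩⟩
  · refine LinearRelation.forall_fin_add.2 ⟨fun i => ?_, fun i => ?_⟩
    · rw [tensor_inp_left, tensor_inp_left]; exact congrArg Sum.inl (f.inp i)
    · rw [tensor_inp_right, tensor_inp_right]; exact congrArg Sum.inr (g.inp i)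
  · refine LinearRelation.forall_fin_add.2 ⟨fun i => ?_, fun i => ?_⟩
    · rw [tensor_out_left, tensor_out_left]; exact congrArg Sum.inl (f.out i)
    · rw [tensor_out_right, tensor_out_right]; exact congrArg Sum.inr (g.out i)
  · rintro (e | e)
    · exact congrArg Sum.inl (f.src e)
    · exact congrArg Sum.inr (g.src e)
  · rintro (e | e)
    · exact congrArg Sum.inl (f.tgt e)
    · exact congrArg Sum.inr (g.tgt e)
  · rintro (e | e)
    · exact f.label e
    · exact g.label e

theorem comp_congr {l m n : ℕ} ⦃a a' : Circuit L l m⦄ (h : a ≈ a') ⦃b b' : Circuit L m n⦄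
    (h' : b ≈ b') : comp a b ≈ comp a' b' := by
  obtain ⟨f⟩ := h
  obtain ⟨g⟩ := h'
  exact comp_sound f g

theorem tensor_congr {m n m' n' : ℕ} ⦃a a' : Circuit L m n⦄ (h : a ≈ a')
    ⦃b b' : Circuit L m' n'⦄ (h' : b ≈ b') : tensor a b ≈ tensor a' b' := by
  obtain ⟨f⟩ := h
  obtain ⟨g⟩ := h'
  exact tensor_sound f g

theorem reindex_sound {m n m' n' : ℕ} {a a' : Circuit L m n} (f : Iso a a') (i : Fin m' → Fin m)
    (o : Fin n' → Fin n) : reindex a i o ≈ reindex a' i o :=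
  ⟨⟨f.node, f.edge, fun _ => f.inp _, fun _ => f.out _, f.src, f.tgt, f.label⟩⟩

/-- Precomposition with a function amounts to a relabelling of the inputs. -/
theorem ofCospan_comp {l m n : ℕ} (i : Fin l → Fin m) (b : Circuit L m n) :
    comp (ofCospan i fun x => x) b ≈ reindex b i fun y => y := by
  refine ⟨⟨⟨Quot.lift (Sum.elim b.inp fun p => p) ?_, fun p => Quot.mk _ (.inr p), ?_, fun p => rfl⟩,
    Equiv.emptySum Empty _, fun x => rfl, fun x => rfl, ?_, ?_, ?_⟩⟩
  · rintro _ _ ⟨y, rfl, rfl⟩; rfl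
  · rintro ⟨p | p⟩
    · exact (Quot.sound ⟨p, rfl, rfl⟩).symm
    · rfl
  all_goals
    rintro (e | e)
    · exact e.elim
    · rfl

/-- Postcomposition with a reversed function amounts to a relabelling of the outputs. -/
theorem comp_ofCospan {l m n : ℕ} (a : Circuit L l m) (o : Fin n → Fin m) :
    comp a (ofCospan (fun x => x) o) ≈ reindex a (fun x => x) o := by
  refine ⟨⟨⟨Quot.lift (Sum.elim (fun p => p) a.out) ?_, fun p => Quot.mk _ (.inl p), ?_, fun p => rfl⟩,
    Equiv.sumEmpty _ Empty, fun x => rfl, fun x => rfl, ?_, ?_, ?_⟩⟩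
  · rintro _ _ ⟨y, rfl, rfl⟩; rfl
  · rintro ⟨p | p⟩
    · rfl
    · exact Quot.sound ⟨p, rfl, rfl⟩
  all_goals
    rintro (e | e)
    · rfl
    · exact e.elim

theorem comp_assoc {l m n p : ℕ} (a : Circuit L l m) (b : Circuit L m n) (c : Circuit L n p) :
    comp (comp a b) c ≈ comp a (comp b c) := by
  refine ⟨⟨⟨?_, ?_, ?_, ?_⟩, Equiv.sumAssoc _ _ _, ?_, ?_, ?_, ?_, ?_⟩⟩
  · refine Quot.lift (Sum.elim (Quot.lift (Sum.elim (fun x => Quot.mk _ (.inl x))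
      fun x => Quot.mk _ (.inr (Quot.mk _ (.inl x)))) ?_)
      fun x => Quot.mk _ (.inr (Quot.mk _ (.inr x)))) ?_
    · rintro _ _ ⟨y, rfl, rfl⟩
      exact Quot.sound ⟨y, rfl, rfl⟩
    · rintro _ _ ⟨y, rfl, rfl⟩
      exact congrArg (fun t => Quot.mk _ (Sum.inr t)) (Quot.sound ⟨y, rfl, rfl⟩)
  · refine Quot.lift (Sum.elim (fun x => Quot.mk _ (.inl (Quot.mk _ (.inl x))))
      (Quot.lift (Sum.elim (fun x => Quot.mk _ (.inl (Quot.mk _ (.inr x))))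
        fun x => Quot.mk _ (.inr x)) ?_)) ?_
    · rintro _ _ ⟨y, rfl, rfl⟩
      exact Quot.sound ⟨y, rfl, rfl⟩
    · rintro _ _ ⟨y, rfl, rfl⟩
      exact congrArg (fun t => Quot.mk _ (Sum.inl t)) (Quot.sound ⟨y, rfl, rfl⟩)
  · rintro ⟨⟨⟨x | x⟩⟩ | x⟩ <;> rfl
  · rintro ⟨x | ⟨⟨x | x⟩⟩⟩ <;> rfl
  · intro x; rfl
  · intro x; rfl
  all_goals rintro ((e | e) | e) <;> rfl

theorem tensor_comp {l m n l' m' n' : ℕ} (a : Circuit L l m) (b : Circuit L m n)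
    (c : Circuit L l' m') (d : Circuit L m' n') :
    tensor (comp a b) (comp c d) ≈ comp (tensor a c) (tensor b d) := by
  refine ⟨⟨⟨?_, ?_, ?_, ?_⟩, Equiv.sumSumSumComm _ _ _ _, ?_, ?_, ?_, ?_, ?_⟩⟩
  · refine Sum.elim (Quot.map (Sum.map .inl .inl) ?_) (Quot.map (Sum.map .inr .inr) ?_)
    · rintro _ _ ⟨y, rfl, rfl⟩
      exact ⟨Fin.castAdd m' y, congrArg Sum.inl (tensor_out_left a c y).symm,
        congrArg Sum.inr (tensor_inp_left b d y).symm⟩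
    · rintro _ _ ⟨y, rfl, rfl⟩
      exact ⟨Fin.natAdd m y, congrArg Sum.inl (tensor_out_right a c y).symm,
        congrArg Sum.inr (tensor_inp_right b d y).symm⟩
  · refine Quot.lift (Sum.elim
      (Sum.map (fun x => Quot.mk _ (.inl x)) fun x => Quot.mk _ (.inl x))
      (Sum.map (fun x => Quot.mk _ (.inr x)) fun x => Quot.mk _ (.inr x))) ?_
    rintro _ _ ⟨y, rfl, rfl⟩
    refine Fin.addCases (fun y => ?_) (fun y => ?_) y
    · rw [tensor_out_left, tensor_inp_left]
      exact congrArg Sum.inl (Quot.sound ⟨y, rfl, rfl⟩)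
    · rw [tensor_out_right, tensor_inp_right]
      exact congrArg Sum.inr (Quot.sound ⟨y, rfl, rfl⟩)
  · rintro (⟨⟨x | x⟩⟩ | ⟨⟨x | x⟩⟩) <;> rfl
  · rintro ⟨(x | x) | (x | x)⟩ <;> rfl
  · refine LinearRelation.forall_fin_add.2 ⟨fun i => ?_, fun i => ?_⟩
    · rw [tensor_inp_left]
      exact congrArg (fun t => Quot.mk _ (Sum.inl t)) (tensor_inp_left a c i).symm
    · rw [tensor_inp_right]
      exact congrArg (fun t => Quot.mk _ (Sum.inl t)) (tensor_inp_right a c i).symm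
  · refine LinearRelation.forall_fin_add.2 ⟨fun i => ?_, fun i => ?_⟩
    · rw [tensor_out_left]
      exact congrArg (fun t => Quot.mk _ (Sum.inr t)) (tensor_out_left b d i).symm
    · rw [tensor_out_right]
      exact congrArg (fun t => Quot.mk _ (Sum.inr t)) (tensor_out_right b d i).symm
  all_goals rintro ((e | e) | (e | e)) <;> rfl

theorem tensor_assoc {m n m' n' m'' n'' : ℕ} (a : Circuit L m n) (b : Circuit L m' n')
    (c : Circuit L m'' n'') :
    reindex (tensor (tensor a b) c) (Fin.cast (add_assoc m m' m'').symm)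
      (Fin.cast (add_assoc n n' n'').symm) ≈ tensor a (tensor b c) := by
  refine ⟨⟨Equiv.sumAssoc _ _ _, Equiv.sumAssoc _ _ _, ?_, ?_, ?_, ?_, ?_⟩⟩
  · refine LinearRelation.forall_fin_add.2 ⟨fun i => ?_, LinearRelation.forall_fin_add.2
      ⟨fun i => ?_, fun i => ?_⟩⟩
    · refine (congrArg (fun t => Equiv.sumAssoc _ _ _ ((tensor (tensor a b) c).inp t))
        LinearRelation.cast_symm_castAdd).trans ?_
      rw [tensor_inp_left, tensor_inp_left, tensor_inp_left]; rfl
    · refine (congrArg (fun t => Equiv.sumAssoc _ _ _ ((tensor (tensor a b) c).inp t))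
        LinearRelation.cast_symm_natAdd_castAdd).trans ?_
      rw [tensor_inp_left, tensor_inp_right, tensor_inp_right, tensor_inp_left]; rfl
    · refine (congrArg (fun t => Equiv.sumAssoc _ _ _ ((tensor (tensor a b) c).inp t))
        LinearRelation.cast_symm_natAdd_natAdd).trans ?_
      rw [tensor_inp_right, tensor_inp_right, tensor_inp_right]; rfl
  · refine LinearRelation.forall_fin_add.2 ⟨fun i => ?_, LinearRelation.forall_fin_add.2
      ⟨fun i => ?_, fun i => ?_⟩⟩
    · refine (congrArg (fun t => Equiv.sumAssoc _ _ _ ((tensor (tensor a b) c).out t))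
        LinearRelation.cast_symm_castAdd).trans ?_
      rw [tensor_out_left, tensor_out_left, tensor_out_left]; rfl
    · refine (congrArg (fun t => Equiv.sumAssoc _ _ _ ((tensor (tensor a b) c).out t))
        LinearRelation.cast_symm_natAdd_castAdd).trans ?_
      rw [tensor_out_left, tensor_out_right, tensor_out_right, tensor_out_left]; rfl
    · refine (congrArg (fun t => Equiv.sumAssoc _ _ _ ((tensor (tensor a b) c).out t))
        LinearRelation.cast_symm_natAdd_natAdd).trans ?_
      rw [tensor_out_right, tensor_out_right, tensor_out_right]; rfl
  all_goals rintro ((e | e) | e) <;> rfl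

theorem tensor_ofCospan {m n m' n' : ℕ} {N N' : Type} [Finite N] [Finite N'] (i : Fin m → N)
    (o : Fin n → N) (i' : Fin m' → N') (o' : Fin n' → N') :
    tensor (ofCospan (L := L) i o) (ofCospan i' o') ≈
      ofCospan (N := N ⊕ N') (Fin.addCases (fun x => .inl (i x)) fun x => .inr (i' x))
        (Fin.addCases (fun x => .inl (o x)) fun x => .inr (o' x)) :=
  ⟨⟨.refl _, Equiv.sumEmpty Empty Empty, fun _ => rfl, fun _ => rfl, by rintro (⟨⟨⟩⟩ | ⟨⟨⟩⟩),
    by rintro (⟨⟨⟩⟩ | ⟨⟨⟩⟩), by rintro (⟨⟨⟩⟩ | ⟨⟨⟩⟩)⟩⟩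

theorem ofCospan_congr {m n : ℕ} {N N' : Type} [Finite N] [Finite N'] {i : Fin m → N}
    {o : Fin n → N} {i' : Fin m → N'} {o' : Fin n → N'} (f : N ≃ N') (hi : ∀ x, f (i x) = i' x)
    (ho : ∀ x, f (o x) = o' x) : ofCospan (L := L) i o ≈ ofCospan i' o' :=
  ⟨⟨f, .refl _, hi, ho, nofun, nofun, nofun⟩⟩

theorem id_zero_tensor {m n : ℕ} (a : Circuit L m n) :
    reindex (tensor (id L 0) a) (Fin.cast (zero_add m).symm) (Fin.cast (zero_add n).symm) ≈ a := by
  have h : ∀ {n : ℕ} (i : Fin n), Fin.cast (zero_add n).symm i = Fin.natAdd 0 i :=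
    fun i => Fin.ext (zero_add _).symm
  refine ⟨⟨Equiv.emptySum (Fin 0) _, Equiv.emptySum Empty _, ?_, ?_, ?_, ?_, ?_⟩⟩
  · intro x
    refine (congrArg (fun t => Equiv.emptySum (Fin 0) _ ((tensor (id L 0) a).inp t)) (h x)).trans ?_
    rw [tensor_inp_right]; rfl
  · intro x
    refine (congrArg (fun t => Equiv.emptySum (Fin 0) _ ((tensor (id L 0) a).out t)) (h x)).trans ?_
    rw [tensor_out_right]; rfl
  all_goals rintro (⟨⟨⟩⟩ | e); rfl

theorem tensor_id_zero {m n : ℕ} (a : Circuit L m n) : tensor a (id L 0) ≈ a := by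
  refine ⟨⟨Equiv.sumEmpty _ (Fin 0), Equiv.sumEmpty _ Empty, ?_, ?_, ?_, ?_, ?_⟩⟩
  · refine LinearRelation.forall_fin_add.2 ⟨fun i => ?_, fun i => i.elim0⟩
    rw [tensor_inp_left]; rfl
  · refine LinearRelation.forall_fin_add.2 ⟨fun i => ?_, fun i => i.elim0⟩
    rw [tensor_out_left]; rfl
  all_goals
    rintro (e | ⟨⟨⟩⟩)
    rfl

theorem swap_swap {m n : ℕ} (x : Fin (m + n)) : swap n m (swap m n x) = x := by
  refine Fin.addCases (fun i => ?_) (fun i => ?_) x <;> simp [swap]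

/-- The map that exchanges the two summands, as a bijection. -/
def swapEquiv (m n : ℕ) : Fin (m + n) ≃ Fin (n + m) := ⟨swap m n, swap n m, swap_swap, swap_swap⟩

theorem braid_eq (m n : ℕ) : braid L m n ≈ ofCospan (fun x => x) (swap n m) :=
  ofCospan_congr (swapEquiv n m) swap_swap fun _ => rfl

theorem tensor_swap {m n m' n' : ℕ} (a : Circuit L m n) (b : Circuit L m' n') :
    reindex (tensor a b) (fun x => x) (swap n' n) ≈
      reindex (tensor b a) (swap m m') fun x => x := by
  refine ⟨⟨Equiv.sumComm _ _, Equiv.sumComm _ _, ?_, ?_, ?_, ?_, ?_⟩⟩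
  · refine LinearRelation.forall_fin_add.2 ⟨fun i => ?_, fun i => ?_⟩ <;> simp only [reindex]
    · rw [swap_castAdd, tensor_inp_left, tensor_inp_right]; rfl
    · rw [swap_natAdd, tensor_inp_right, tensor_inp_left]; rfl
  · refine LinearRelation.forall_fin_add.2 ⟨fun i => ?_, fun i => ?_⟩ <;> simp only [reindex]
    · rw [swap_castAdd, tensor_out_left, tensor_out_right]; rfl
    · rw [swap_natAdd, tensor_out_right, tensor_out_left]; rfl
  all_goals rintro (e | e) <;> rfl

/-- The sum of two functions between finite ordinals. -/
def sumMap {m n m' n' : ℕ} (i : Fin m → Fin n) (i' : Fin m' → Fin n') :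
    Fin (m + m') → Fin (n + n') :=
  Fin.addCases (fun x => Fin.castAdd n' (i x)) fun x => Fin.natAdd n (i' x)

theorem tensor_ofCospan_fun {m n m' n' : ℕ} (i : Fin m → Fin n) (i' : Fin m' → Fin n') :
    tensor (ofCospan (L := L) i fun x => x) (ofCospan i' fun x => x) ≈
      ofCospan (sumMap i i') fun x => x := by
  refine Setoid.trans (tensor_ofCospan _ _ _ _) (ofCospan_congr finSumFinEquiv
    (LinearRelation.forall_fin_add.2 ⟨fun x => ?_, fun x => ?_⟩)
    (LinearRelation.forall_fin_add.2 ⟨fun x => ?_, fun x => ?_⟩)) <;> simp [sumMap]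

theorem hexagon_fun (m n p : ℕ) : ∀ x : Fin (m + n + p),
    Fin.cast (add_assoc n p m).symm (sumMap (fun x => x) (swap m p)
      (Fin.cast (add_assoc n m p) (sumMap (swap m n) (fun x => x) x))) =
    swap m (n + p) (Fin.cast (add_assoc m n p) x) := by
  refine LinearRelation.forall_fin_add.2 ⟨LinearRelation.forall_fin_add.2
    ⟨fun i => ?_, fun i => ?_⟩, fun i => ?_⟩
  · rw [LinearRelation.cast_castAdd_castAdd, swap_castAdd]
    simp only [sumMap, Fin.addCases_left, swap_castAdd, LinearRelation.cast_castAdd_natAdd,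
      Fin.addCases_right]
    exact LinearRelation.cast_symm_natAdd_natAdd
  · rw [LinearRelation.cast_castAdd_natAdd, swap_natAdd]
    simp only [sumMap, Fin.addCases_left, swap_natAdd, LinearRelation.cast_castAdd_castAdd]
    exact LinearRelation.cast_symm_castAdd
  · rw [LinearRelation.cast_natAdd, swap_natAdd]
    simp only [sumMap, swap_natAdd, LinearRelation.cast_natAdd, Fin.addCases_right]
    exact LinearRelation.cast_symm_natAdd_castAdd

theorem hexagon_aux (m n p : ℕ) :
    reindex (braid L m (n + p)) (Fin.cast (add_assoc m n p).symm.symm)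
      (Fin.cast (add_assoc n p m).symm) ≈
    comp (reindex (tensor (braid L m n) (id L p)) (Fin.cast rfl)
      (Fin.cast (add_assoc n m p).symm)) (tensor (id L n) (braid L m p)) := by
  have h1 : reindex (tensor (braid L m n) (id L p)) (Fin.cast rfl)
      (Fin.cast (add_assoc n m p).symm) ≈
      ofCospan (fun x => Fin.cast (add_assoc n m p) (sumMap (swap m n) (fun x => x) x))
        fun x => x := by
    obtain ⟨f⟩ := tensor_ofCospan_fun (L := L) (swap m n) (fun x : Fin p => x)
    exact Setoid.trans (reindex_sound f _ _)
      (ofCospan_congr (finCongr (add_assoc n m p)) (fun _ => rfl) fun _ => rfl)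
  obtain ⟨f⟩ := h1
  obtain ⟨g⟩ := Setoid.refl (tensor (id L n) (braid L m p))
  obtain ⟨h⟩ := tensor_ofCospan_fun (L := L) (fun x : Fin n => x) (swap m p)
  refine Setoid.symm (Setoid.trans (comp_sound f g) (Setoid.trans (ofCospan_comp _ _)
    (Setoid.trans (reindex_sound h _ _) ?_)))
  exact ofCospan_congr (finCongr (add_assoc n p m).symm) (hexagon_fun m n p) fun _ => rfl

end Circuit

/-- Isomorphism classes of `L`-circuits from `m` to `n`. -/
def CircHom (L : Type u) (m n : ℕ) : Type (max u 1) := Quotient (Circuit.setoid L m n)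

theorem castHom_mk {L : Type u} {m m' n n' : ℕ} (hm : m = m') (hn : n = n') (a : Circuit L m n) :
    castHom (H := CircHom L) hm hn (Quotient.mk _ a) =
      Quotient.mk _ (a.reindex (Fin.cast hm.symm) (Fin.cast hn.symm)) := by
  subst hm hn; rfl

/-- The prop of `L`-circuits. -/
def Circ (L : Type u) : PROP.{max u 1} where
  Hom := CircHom L
  id n := Quotient.mk _ (Circuit.id L n)
  comp := Quotient.map₂ Circuit.comp Circuit.comp_congr
  tensor := Quotient.map₂ Circuit.tensor Circuit.tensor_congr
  braid m n := Quotient.mk _ (Circuit.braid L m n)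
  id_comp := by rintro m n ⟨a⟩; exact Quotient.sound (Circuit.ofCospan_comp _ a)
  comp_id := by rintro m n ⟨a⟩; exact Quotient.sound (Circuit.comp_ofCospan a _)
  assoc := by rintro _ _ _ _ ⟨a⟩ ⟨b⟩ ⟨c⟩; exact Quotient.sound (Circuit.comp_assoc a b c)
  tensor_id m n := Quotient.sound (Setoid.trans (Circuit.tensor_ofCospan _ _ _ _)
    (Circuit.ofCospan_congr finSumFinEquiv
      (fun x => by refine Fin.addCases (fun i => ?_) (fun i => ?_) x <;> simp)
      (fun x => by refine Fin.addCases (fun i => ?_) (fun i => ?_) x <;> simp)))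
  tensor_comp := by
    rintro _ _ _ _ _ _ ⟨a⟩ ⟨b⟩ ⟨c⟩ ⟨d⟩; exact Quotient.sound (Circuit.tensor_comp a b c d)
  tensor_assoc := by
    rintro _ _ _ _ _ _ ⟨a⟩ ⟨b⟩ ⟨c⟩
    exact (castHom_mk _ _ _).trans (Quotient.sound (Circuit.tensor_assoc a b c))
  id_zero_tensor := by
    rintro _ _ ⟨a⟩
    exact (castHom_mk _ _ _).trans (Quotient.sound (Circuit.id_zero_tensor a))
  tensor_id_zero := by
    rintro _ _ ⟨a⟩
    exact (castHom_mk _ _ _).trans (Quotient.sound (Circuit.tensor_id_zero a))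
  braid_natural := by
    rintro m n m' n' ⟨a⟩ ⟨b⟩
    refine Quotient.sound ?_
    obtain ⟨f⟩ := Circuit.braid_eq (L := L) n n'
    obtain ⟨g⟩ := Setoid.refl (Circuit.tensor a b)
    exact Setoid.trans (Circuit.comp_sound g f) (Setoid.trans (Circuit.comp_ofCospan _ _)
      (Setoid.trans (Circuit.tensor_swap a b) (Setoid.symm (Circuit.ofCospan_comp _ _))))
  braid_symm m n := Quotient.sound (Setoid.trans (Circuit.ofCospan_comp _ _)
    (Circuit.ofCospan_congr (.refl _) (fun x => Circuit.swap_swap x) fun _ => rfl))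
  braid_zero n := (castHom_mk _ _ _).trans (Quotient.sound
    (Circuit.ofCospan_congr (.refl _) (fun x => by
      have : Fin.cast (zero_add n).symm x = Fin.natAdd 0 x := Fin.ext (zero_add _).symm
      exact (congrArg (Circuit.swap 0 n) this).trans (Circuit.swap_natAdd x)) fun _ => rfl))
  hexagon m n p := (castHom_mk _ _ _).trans ((Quotient.sound (Circuit.hexagon_aux m n p)).trans
    (congrArg (fun t => Quotient.map₂ Circuit.comp Circuit.comp_congr t
        (Quotient.mk _ (Circuit.tensor (Circuit.id L n) (Circuit.braid L m p))))
      (castHom_mk _ _ _).symm))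

end Circuits

section BlackBoxing

variable {k : Type u} [Field k]

/-- Solvability criterion for a system of linear equations over a field. -/
theorem exists_solution {ι : Type} [Fintype ι] {U : Type u} [AddCommGroup U] [Module k U]
    (A : U →ₗ[k] (ι → k)) (b : ι → k)
    (h : ∀ c : ι → k, (∀ u, ∑ i, c i * A u i = 0) → ∑ i, c i * b i = 0) : ∃ u, A u = b := by
  classical
  by_contra hb
  obtain ⟨f, hfb, hf⟩ := Submodule.exists_le_ker_of_notMem (p := LinearMap.range A) (v := b) hb
  have hfs : ∀ v : ι → k, f v = ∑ i, f (Pi.single i 1) * v i := fun v => by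
    rw [LinearMap.pi_apply_eq_sum_univ f v]
    refine Finset.sum_congr rfl fun i _ => ?_
    rw [smul_eq_mul, mul_comm]
    congr 2
    funext j
    simp [Pi.single_apply, eq_comm]
  refine hfb ((hfs b).trans (h (fun i => f (Pi.single i 1)) fun u => ?_))
  rw [← hfs]
  exact hf ⟨u, rfl⟩

open Classical in
/-- The linear map that sums a function along the fibres of `g`. -/
noncomputable def push {ι N : Type} [Fintype ι] (g : ι → N) : (ι → k) →ₗ[k] (N → k) where
  toFun h p := ∑ i, if g i = p then h i else 0
  map_add' h h' := by
    funext p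
    rw [Pi.add_apply, ← Finset.sum_add_distrib]
    exact Finset.sum_congr rfl fun i _ => by split_ifs <;> simp
  map_smul' c h := by
    funext p
    rw [Pi.smul_apply, Finset.smul_sum]
    exact Finset.sum_congr rfl fun i _ => by split_ifs <;> simp

theorem sum_mul_push {ι N : Type} [Fintype ι] [Fintype N] (g : ι → N) (h : ι → k) (f : N → k) :
    ∑ p, f p * push g h p = ∑ i, f (g i) * h i := by
  classical
  simp only [push, LinearMap.coe_mk, AddHom.coe_mk, Finset.mul_sum]
  rw [Finset.sum_comm]
  exact Finset.sum_congr rfl fun i _ => by simp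

theorem finsum_fibre {ι N : Type} [Fintype ι] (g : ι → N) (h : ι → k) (p : N) :
    ∑ᶠ (i) (_ : g i = p), h i = push g h p := by
  classical
  rw [finsum_eq_sum_of_fintype]
  exact Finset.sum_congr rfl fun i _ => finsum_eq_if

namespace Circuit

/-- The laws obeyed by the potentials and currents in a linear circuit: `x` and `y` give the
potential and the current at each input and at each output, `φ` the potentials at the nodes, and
`J` the currents along the edges. -/
structure IsState {m n : ℕ} (c : Circuit k m n) (x : Fin m → k × k) (y : Fin n → k × k)
    (φ : c.Node → k) (J : c.Edge → k) : Prop where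
  inp : ∀ i, φ (c.inp i) = (x i).1
  out : ∀ j, φ (c.out j) = (y j).1
  /-- Ohm's law: the voltage across an edge is the impedance times the current through it. -/
  ohm : ∀ e, φ (c.tgt e) - φ (c.src e) = c.label e * J e
  /-- Kirchhoff's current law: the current that flows into a node flows out of it. -/
  kirchhoff : ∀ p,
    ∑ᶠ (i) (_ : c.inp i = p), (x i).2 + ∑ᶠ (e) (_ : c.tgt e = p), J e =
      ∑ᶠ (j) (_ : c.out j = p), (y j).2 + ∑ᶠ (e) (_ : c.src e = p), J e

theorem kirchhoff_iff {m n : ℕ} (c : Circuit k m n) [Fintype c.Edge] (I : Fin m → k) (I' : Fin n → k)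
    (J : c.Edge → k) :
    (∀ p, ∑ᶠ (i) (_ : c.inp i = p), I i + ∑ᶠ (e) (_ : c.tgt e = p), J e =
      ∑ᶠ (j) (_ : c.out j = p), I' j + ∑ᶠ (e) (_ : c.src e = p), J e) ↔
    ∀ f : c.Node → k, ∑ i, f (c.inp i) * I i + ∑ e, (f (c.tgt e) - f (c.src e)) * J e =
      ∑ j, f (c.out j) * I' j := by
  classical
  have := Fintype.ofFinite c.Node
  simp only [finsum_fibre, sub_mul, Finset.sum_sub_distrib]
  have e (f : c.Node → k) : (∑ i, f (c.inp i) * I i +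
      (∑ e, f (c.tgt e) * J e - ∑ e, f (c.src e) * J e) = ∑ j, f (c.out j) * I' j) ↔
      (∑ p, f p * push c.inp I p + (∑ p, f p * push c.tgt J p - ∑ p, f p * push c.src J p) =
        ∑ p, f p * push c.out I' p) := by simp only [sum_mul_push]
  simp only [e]
  constructor
  · intro h f
    have h' : ∑ p, f p * (push c.inp I p + push c.tgt J p) =
        ∑ p, f p * (push c.out I' p + push c.src J p) :=
      Finset.sum_congr rfl fun p _ => by rw [h p]
    simp only [mul_add, Finset.sum_add_distrib] at h'
    rw [← add_sub_assoc, h', add_sub_cancel_right]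
  · intro h p
    have h' := h (Pi.single p 1)
    simp only [Pi.single_apply, ite_mul, one_mul, zero_mul, Finset.sum_ite_eq', Finset.mem_univ,
      if_true] at h'
    rw [← h']
    ring

theorem isState_iff {m n : ℕ} (c : Circuit k m n) [Fintype c.Edge] (x : Fin m → k × k)
    (y : Fin n → k × k) (φ : c.Node → k) (J : c.Edge → k) :
    IsState c x y φ J ↔ (∀ i, φ (c.inp i) = (x i).1) ∧ (∀ j, φ (c.out j) = (y j).1) ∧
      (∀ e, φ (c.tgt e) - φ (c.src e) = c.label e * J e) ∧
      ∀ f : c.Node → k, ∑ i, f (c.inp i) * (x i).2 + ∑ e, (f (c.tgt e) - f (c.src e)) * J e =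
        ∑ j, f (c.out j) * (y j).2 := by
  rw [← kirchhoff_iff]
  exact ⟨fun h => ⟨h.1, h.2, h.3, h.4⟩, fun h => ⟨h.1, h.2.1, h.2.2.1, h.2.2.2⟩⟩

/-- The behaviour of a linear circuit: the relation between the potentials and currents at its
inputs and those at its outputs. -/
def behavior {m n : ℕ} (c : Circuit k m n) : LinearRelation k (k × k) m n where
  carrier := {p | ∃ φ J, IsState c p.1 p.2 φ J}
  add_mem' := by
    have := Fintype.ofFinite c.Edge
    rintro p q ⟨φ, J, h⟩ ⟨φ', J', h'⟩
    rw [isState_iff] at h h'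
    refine ⟨φ + φ', J + J', (isState_iff _ _ _ _ _).2 ⟨fun i => ?_, fun i => ?_, fun e => ?_,
      fun f => ?_⟩⟩
    · simp [h.1, h'.1]
    · simp [h.2.1, h'.2.1]
    · simp only [Pi.add_apply, mul_add, ← h.2.2.1, ← h'.2.2.1]; ring
    · have e1 := h.2.2.2 f
      have e2 := h'.2.2.2 f
      simp only [Prod.fst_add, Prod.snd_add, Pi.add_apply, mul_add, Finset.sum_add_distrib]
      rw [← e1, ← e2]; ring
  zero_mem' := by
    have := Fintype.ofFinite c.Edge
    exact ⟨0, 0, (isState_iff _ _ _ _ _).2 (by simp)⟩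
  smul_mem' := by
    have := Fintype.ofFinite c.Edge
    rintro r p ⟨φ, J, h⟩
    rw [isState_iff] at h
    refine ⟨r • φ, r • J, (isState_iff _ _ _ _ _).2 ⟨fun i => ?_, fun i => ?_, fun e => ?_,
      fun f => ?_⟩⟩
    · simp [h.1]
    · simp [h.2.1]
    · simp only [Pi.smul_apply, smul_eq_mul, mul_left_comm _ r, ← h.2.2.1]; ring
    · have e1 := h.2.2.2 f
      simp only [Prod.smul_fst, Prod.smul_snd, Pi.smul_apply, smul_eq_mul, mul_left_comm _ r,
        ← Finset.mul_sum]
      rw [← e1]; ring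

theorem mem_behavior {m n : ℕ} {c : Circuit k m n} {x : Fin m → k × k} {y : Fin n → k × k} :
    (x, y) ∈ behavior c ↔ ∃ φ J, IsState c x y φ J := Iff.rfl

theorem isLagrangianRelation_behavior {m n : ℕ} (c : Circuit k m n) :
    IsLagrangianRelation (behavior c) := by
  classical
  have := Fintype.ofFinite c.Edge
  have := Fintype.ofFinite c.Node
  rw [isLagrangianRelation_iff]
  intro x y
  simp only [mem_behavior, isState_iff]
  constructor
  · rintro ⟨φ, J, h1, h2, h3, h4⟩ x' y' ⟨φ', J', h1', h2', h3', h4'⟩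
    have e := h4 φ'
    have e' := h4' φ
    simp only [h1, h2, h3, h1', h2', h3'] at e e'
    simp only [sympForm_apply, Finset.sum_sub_distrib]
    rw [← e, ← e', add_sub_add_comm, ← Finset.sum_sub_distrib (f := fun e => c.label e * J e * J' e)]
    rw [left_eq_add]
    exact Finset.sum_eq_zero fun e _ => by ring
  · intro h
    let A : (c.Node → k) × (c.Edge → k) →ₗ[k] ((Fin m ⊕ Fin n) ⊕ (c.Edge ⊕ c.Node) → k) :=
      { toFun := fun u => Sum.elim (Sum.elim (fun i => u.1 (c.inp i)) fun j => u.1 (c.out j))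
          (Sum.elim (fun e => u.1 (c.tgt e) - u.1 (c.src e) - c.label e * u.2 e)
            (push c.tgt u.2 - push c.src u.2))
        map_add' := fun u v => by
          funext s
          rcases s with (s | s) | (s | s)
          · rfl
          · rfl
          · simp only [Prod.fst_add, Prod.snd_add, Pi.add_apply, Sum.elim_inr, Sum.elim_inl]; ring
          · simp only [Prod.fst_add, Prod.snd_add, Pi.add_apply, Sum.elim_inr, map_add,
              Pi.sub_apply]; ring
        map_smul' := fun r u => by
          funext s
          rcases s with (s | s) | (s | s)
          · rfl
          · rfl
          · simp only [Prod.smul_fst, Prod.smul_snd, Pi.smul_apply, Sum.elim_inr, Sum.elim_inl,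
              smul_eq_mul, RingHom.id_apply]; ring
          · simp only [Prod.smul_fst, Prod.smul_snd, Pi.smul_apply, Sum.elim_inr, map_smul,
              Pi.sub_apply, smul_eq_mul, RingHom.id_apply]; ring }
    obtain ⟨⟨φ, J⟩, hu⟩ := exists_solution A
      (Sum.elim (Sum.elim (fun i => (x i).1) fun j => (y j).1)
        (Sum.elim (fun _ => 0) (push c.out (fun j => (y j).2) - push c.inp fun i => (x i).2)))
      (by
        intro w hw
        simp only [Fintype.sum_sum_type, A, LinearMap.coe_mk, AddHom.coe_mk, Sum.elim_inl,
          Sum.elim_inr, Pi.sub_apply, mul_sub (w _) (push _ _ _), Finset.sum_sub_distrib (f := fun p => w _ * push _ _ p),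
          sum_mul_push c.tgt _ fun p => w (.inr (.inr p)),
          sum_mul_push c.src _ fun p => w (.inr (.inr p)),
          sum_mul_push c.out _ fun p => w (.inr (.inr p)),
          sum_mul_push c.inp _ fun p => w (.inr (.inr p))] at hw ⊢
        have key := h (fun i => (w (.inr (.inr (c.inp i))), w (.inl (.inl i))))
          (fun j => (w (.inr (.inr (c.out j))), -w (.inl (.inr j))))
          ⟨fun p => w (.inr (.inr p)), fun e => w (.inr (.inl e)), fun _ => rfl, fun _ => rfl,
            fun e => by
              have := hw (0, Pi.single e 1)
              simp [Pi.single_apply] at this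
              linear_combination this, fun f => by
              have := hw (f, 0)
              simp at this
              simp only [mul_comm (f _ - f _), mul_comm (f _), neg_mul, Finset.sum_neg_distrib]
              linear_combination this⟩
        simp only [sympForm_apply, Finset.sum_sub_distrib, mul_neg, Finset.sum_neg_distrib] at key
        simp only [mul_zero, Finset.sum_const_zero, mul_comm (w (.inl _))]
        linear_combination key)
    refine ⟨φ, J, fun i => congrFun hu (.inl (.inl i)), fun j => congrFun hu (.inl (.inr j)),
      fun e => sub_eq_zero.1 (congrFun hu (.inr (.inl e))), ?_⟩
    rw [← kirchhoff_iff]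
    intro p
    have := congrFun hu (.inr (.inr p))
    simp only [A, LinearMap.coe_mk, AddHom.coe_mk, Sum.elim_inr, Pi.sub_apply] at this
    simp only [finsum_fibre]
    linear_combination this

theorem behavior_le_of_iso {m n : ℕ} {a b : Circuit k m n} (f : Iso a b) :
    behavior a ≤ behavior b := by
  have := Fintype.ofFinite a.Edge
  have := Fintype.ofFinite b.Edge
  rintro ⟨x, y⟩ h
  obtain ⟨φ, J, h⟩ := mem_behavior.1 h
  obtain ⟨h1, h2, h3, h4⟩ := (isState_iff _ _ _ _ _).1 h
  refine ⟨fun p => φ (f.node.symm p), fun e => J (f.edge.symm e), (isState_iff _ _ _ _ _).2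
    ⟨fun i => ?_, fun j => ?_, fun e => ?_, fun g => ?_⟩⟩
  · rw [← f.inp, Equiv.symm_apply_apply]; exact h1 i
  · rw [← f.out, Equiv.symm_apply_apply]; exact h2 j
  · obtain ⟨e, rfl⟩ := f.edge.surjective e
    rw [← f.src, ← f.tgt, ← f.label]
    simp only [Equiv.symm_apply_apply]
    exact h3 e
  · rw [← f.edge.sum_comp]
    simp only [← f.inp, ← f.out, ← f.src, ← f.tgt, Equiv.symm_apply_apply]
    exact h4 fun p => g (f.node p)

theorem behavior_congr {m n : ℕ} {a b : Circuit k m n} (h : a ≈ b) : behavior a = behavior b := by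
  obtain ⟨g⟩ := Setoid.symm h
  obtain ⟨f⟩ := h
  exact le_antisymm (behavior_le_of_iso f) (behavior_le_of_iso g)

theorem isState_comp {l m n : ℕ} {a : Circuit k l m} {b : Circuit k m n} [Fintype a.Edge]
    [Fintype b.Edge] {x : Fin l → k × k} {z : Fin n → k × k} {φ : Quot (Glue a b) → k}
    {J : a.Edge ⊕ b.Edge → k} :
    IsState (comp a b) x z φ J ↔
      (∀ i, φ (Quot.mk _ (.inl (a.inp i))) = (x i).1) ∧
      (∀ j, φ (Quot.mk _ (.inr (b.out j))) = (z j).1) ∧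
      (∀ e, φ (Quot.mk _ (.inl (a.tgt e))) - φ (Quot.mk _ (.inl (a.src e))) =
        a.label e * J (.inl e)) ∧
      (∀ e, φ (Quot.mk _ (.inr (b.tgt e))) - φ (Quot.mk _ (.inr (b.src e))) =
        b.label e * J (.inr e)) ∧
      ∀ f : Quot (Glue a b) → k, ∑ i, f (Quot.mk _ (.inl (a.inp i))) * (x i).2 +
        (∑ e, (f (Quot.mk _ (.inl (a.tgt e))) - f (Quot.mk _ (.inl (a.src e)))) * J (.inl e) +
          ∑ e, (f (Quot.mk _ (.inr (b.tgt e))) - f (Quot.mk _ (.inr (b.src e)))) * J (.inr e)) =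
        ∑ j, f (Quot.mk _ (.inr (b.out j))) * (z j).2 := by
  let : Fintype (comp a b).Edge := inferInstanceAs (Fintype (a.Edge ⊕ b.Edge))
  have hs (g : a.Edge ⊕ b.Edge → k) : ∑ e : (comp a b).Edge, g e =
    ∑ e, g (.inl e) + ∑ e, g (.inr e) := Fintype.sum_sum_type g
  refine (isState_iff (comp a b) x z φ J).trans ?_
  constructor
  · rintro ⟨h1, h2, h3, h4⟩
    exact ⟨h1, h2, fun e => h3 (.inl e), fun e => h3 (.inr e), fun f =>
      (congrArg (_ + ·) (hs _).symm).trans (h4 f)⟩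
  · rintro ⟨h1, h2, h3, h3', h4⟩
    exact ⟨h1, h2, fun e => Sum.rec h3 h3' e, fun f => (congrArg (_ + ·) (hs _)).trans (h4 f)⟩

theorem behavior_comp {l m n : ℕ} (a : Circuit k l m) (b : Circuit k m n) :
    behavior (comp a b) = (behavior a).comp (behavior b) := by
  classical
  have := Fintype.ofFinite a.Edge
  have := Fintype.ofFinite b.Edge
  have := Fintype.ofFinite a.Node
  have := Fintype.ofFinite b.Node
  refine LinearRelation.ext' fun x z => ?_
  rw [LinearRelation.mem_comp]
  constructor
  · intro h
    obtain ⟨φ, J, h⟩ := mem_behavior.1 h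
    obtain ⟨h1, h2, h3, h3', h4⟩ := isState_comp.1 h
    let A : (Fin m → k) →ₗ[k] (a.Node ⊕ b.Node → k) :=
      { toFun := fun I => Sum.elim (push a.out I) (-push b.inp I)
        map_add' := fun I I' => by
          funext s
          rcases s with s | s
          · simp
          · simp; ring
        map_smul' := fun r I => by
          funext s
          rcases s with s | s <;> simp }
    obtain ⟨I, hI⟩ := exists_solution A
      (Sum.elim (push a.inp (fun i => (x i).2) + (push a.tgt (fun e => J (.inl e)) -
          push a.src fun e => J (.inl e)))
        (push b.tgt (fun e => J (.inr e)) - push b.src (fun e => J (.inr e)) -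
          push b.out fun j => (z j).2))
      (by
        intro c hc
        simp only [Fintype.sum_sum_type, A, LinearMap.coe_mk, AddHom.coe_mk, Sum.elim_inl,
          Sum.elim_inr, Pi.neg_apply, mul_neg, Finset.sum_neg_distrib,
          sum_mul_push a.out _ fun p => c (.inl p), sum_mul_push b.inp _ fun p => c (.inr p)] at hc
        have hc' : ∀ p q, Glue a b p q → c p = c q := by
          rintro _ _ ⟨y, rfl, rfl⟩
          have := hc (Pi.single y 1)
          simp only [Pi.single_apply, mul_ite, mul_one, mul_zero, Finset.sum_ite_eq',
            Finset.mem_univ, if_true] at this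
          linear_combination this
        have key := h4 (Quot.lift c hc')
        simp only [Fintype.sum_sum_type, Sum.elim_inl, Sum.elim_inr, Pi.add_apply, Pi.sub_apply,
          mul_add, mul_sub, Finset.sum_add_distrib, Finset.sum_sub_distrib,
          sum_mul_push a.inp _ fun p => c (.inl p), sum_mul_push a.tgt _ fun p => c (.inl p),
          sum_mul_push a.src _ fun p => c (.inl p), sum_mul_push b.tgt _ fun p => c (.inr p),
          sum_mul_push b.src _ fun p => c (.inr p), sum_mul_push b.out _ fun p => c (.inr p)]
        simp only [sub_mul, Finset.sum_sub_distrib] at key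
        linear_combination key)
    refine ⟨fun y => (φ (Quot.mk _ (.inl (a.out y))), I y),
      ⟨fun p => φ (Quot.mk _ (.inl p)), fun e => J (.inl e), h1, fun _ => rfl, h3, fun p => ?_⟩,
      ⟨fun p => φ (Quot.mk _ (.inr p)), fun e => J (.inr e),
        fun y => congrArg φ (Quot.sound ⟨y, rfl, rfl⟩).symm, h2, h3', fun p => ?_⟩⟩
    · have := congrFun hI (.inl p)
      simp only [A, LinearMap.coe_mk, AddHom.coe_mk, Sum.elim_inl, Pi.add_apply,
        Pi.sub_apply] at this
      simp only [finsum_fibre]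
      linear_combination -this
    · have := congrFun hI (.inr p)
      simp only [A, LinearMap.coe_mk, AddHom.coe_mk, Sum.elim_inr, Pi.neg_apply,
        Pi.sub_apply] at this
      simp only [finsum_fibre]
      linear_combination -this
  · rintro ⟨y, ⟨φ, J, h⟩, ⟨φ', J', h'⟩⟩
    obtain ⟨h1, h2, h3, h4⟩ := (isState_iff _ _ _ _ _).1 h
    obtain ⟨h1', h2', h3', h4'⟩ := (isState_iff _ _ _ _ _).1 h'
    refine ⟨Quot.lift (Sum.elim φ φ') ?_, Sum.elim J J', isState_comp.2
      ⟨h1, h2', h3, h3', fun f => ?_⟩⟩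
    · rintro _ _ ⟨y, rfl, rfl⟩
      exact (h2 y).trans (h1' y).symm
    · have e := h4 fun p => f (Quot.mk _ (.inl p))
      have e' := h4' fun p => f (Quot.mk _ (.inr p))
      have hf : ∀ y, f (Quot.mk _ (.inl (a.out y))) = f (Quot.mk _ (.inr (b.inp y))) :=
        fun y => congrArg f (Quot.sound ⟨y, rfl, rfl⟩)
      simp only [hf] at e
      simp only [Sum.elim_inl, Sum.elim_inr]
      linear_combination e + e'

theorem isState_tensor {m n m' n' : ℕ} {a : Circuit k m n} {b : Circuit k m' n'}
    {x : Fin (m + m') → k × k} {y : Fin (n + n') → k × k} {φ : a.Node ⊕ b.Node → k}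
    {J : a.Edge ⊕ b.Edge → k} :
    IsState (tensor a b) x y φ J ↔
      IsState a (fun i => x (Fin.castAdd m' i)) (fun j => y (Fin.castAdd n' j))
        (fun p => φ (.inl p)) (fun e => J (.inl e)) ∧
      IsState b (fun i => x (Fin.natAdd m i)) (fun j => y (Fin.natAdd n j))
        (fun p => φ (.inr p)) (fun e => J (.inr e)) := by
  have := Fintype.ofFinite a.Edge
  have := Fintype.ofFinite b.Edge
  let : Fintype (tensor a b).Edge := inferInstanceAs (Fintype (a.Edge ⊕ b.Edge))
  have hs (g : a.Edge ⊕ b.Edge → k) : ∑ e : (tensor a b).Edge, g e =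
    ∑ e, g (.inl e) + ∑ e, g (.inr e) := Fintype.sum_sum_type g
  have hE (f : a.Node ⊕ b.Node → k) : (∑ e : (tensor a b).Edge,
      (f ((tensor a b).tgt e) - f ((tensor a b).src e)) * J e) =
      ∑ e, (f (.inl (a.tgt e)) - f (.inl (a.src e))) * J (.inl e) +
      ∑ e, (f (.inr (b.tgt e)) - f (.inr (b.src e))) * J (.inr e) := hs _
  have hI (f : a.Node ⊕ b.Node → k) : ∑ i, f ((tensor a b).inp i) * (x i).2 =
      ∑ i, f (.inl (a.inp i)) * (x (Fin.castAdd m' i)).2 +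
      ∑ i, f (.inr (b.inp i)) * (x (Fin.natAdd m i)).2 := by
    simp only [Fin.sum_univ_add, tensor_inp_left, tensor_inp_right]
  have hO (f : a.Node ⊕ b.Node → k) : ∑ i, f ((tensor a b).out i) * (y i).2 =
      ∑ i, f (.inl (a.out i)) * (y (Fin.castAdd n' i)).2 +
      ∑ i, f (.inr (b.out i)) * (y (Fin.natAdd n i)).2 := by
    simp only [Fin.sum_univ_add, tensor_out_left, tensor_out_right]
  rw [isState_iff a, isState_iff b]
  refine (isState_iff (tensor a b) x y φ J).trans ?_
  constructor
  · rintro ⟨h1, h2, h3, h4⟩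
    refine ⟨⟨fun i => ?_, fun j => ?_, fun e => h3 (.inl e), fun f => ?_⟩,
      ⟨fun i => ?_, fun j => ?_, fun e => h3 (.inr e), fun f => ?_⟩⟩
    · rw [← h1, tensor_inp_left]
    · rw [← h2, tensor_out_left]
    · have := h4 (Sum.elim f 0)
      rw [hE, hI, hO] at this
      simpa using this
    · rw [← h1, tensor_inp_right]
    · rw [← h2, tensor_out_right]
    · have := h4 (Sum.elim 0 f)
      rw [hE, hI, hO] at this
      simpa using this
  · rintro ⟨⟨h1, h2, h3, h4⟩, ⟨h1', h2', h3', h4'⟩⟩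
    refine ⟨LinearRelation.forall_fin_add.2 ⟨fun i => ?_, fun i => ?_⟩,
      LinearRelation.forall_fin_add.2 ⟨fun i => ?_, fun i => ?_⟩, fun e => Sum.rec h3 h3' e,
      fun f => ?_⟩
    · rw [tensor_inp_left]; exact h1 i
    · rw [tensor_inp_right]; exact h1' i
    · rw [tensor_out_left]; exact h2 i
    · rw [tensor_out_right]; exact h2' i
    · refine (congrArg₂ (· + ·) (hI f) (hE f)).trans (Eq.trans ?_ (hO f).symm)
      linear_combination h4 (fun p => f (.inl p)) + h4' fun p => f (.inr p)

theorem behavior_tensor {m n m' n' : ℕ} (a : Circuit k m n) (b : Circuit k m' n') :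
    behavior (tensor a b) = (behavior a).tensor (behavior b) := by
  refine LinearRelation.ext' fun x y => ?_
  rw [LinearRelation.mem_tensor]
  constructor
  · rintro ⟨φ, J, h⟩
    have := isState_tensor.1 h
    exact ⟨⟨_, _, this.1⟩, ⟨_, _, this.2⟩⟩
  · rintro ⟨⟨φ, J, h⟩, ⟨φ', J', h'⟩⟩
    exact ⟨Sum.elim φ φ', Sum.elim J J', isState_tensor.2 ⟨h, h'⟩⟩

theorem mem_behavior_ofCospan {m n : ℕ} {N : Type} [Finite N] {i : Fin m → N} {o : Fin n → N}
    {x : Fin m → k × k} {y : Fin n → k × k} :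
    (x, y) ∈ behavior (ofCospan i o) ↔
      (∃ φ : N → k, (∀ s, φ (i s) = (x s).1) ∧ ∀ t, φ (o t) = (y t).1) ∧
      ∀ f : N → k, ∑ s, f (i s) * (x s).2 = ∑ t, f (o t) * (y t).2 := by
  let : Fintype (ofCospan (L := k) i o).Edge := inferInstanceAs (Fintype Empty)
  rw [mem_behavior]
  simp only [isState_iff]
  have hs (g : Empty → k) : ∑ e : (ofCospan (L := k) i o).Edge, g e = 0 := Fintype.sum_empty g
  constructor
  · rintro ⟨φ, J, h1, h2, h3, h4⟩
    refine ⟨⟨φ, h1, h2⟩, fun f => ?_⟩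
    exact ((add_zero _).symm.trans (congrArg (_ + ·) (hs _).symm)).trans (h4 f)
  · rintro ⟨⟨φ, h1, h2⟩, h4⟩
    exact ⟨φ, 0, h1, h2, fun e => e.elim, fun f =>
      ((congrArg (_ + ·) (hs _)).trans (add_zero _)).trans (h4 f)⟩

theorem mem_behavior_ofEquiv {m n : ℕ} (i : Fin m ≃ Fin n) {x : Fin m → k × k}
    {y : Fin n → k × k} :
    (x, y) ∈ behavior (ofCospan i fun t => t) ↔ ∀ s, y (i s) = x s := by
  classical
  rw [mem_behavior_ofCospan]
  constructor
  · rintro ⟨⟨φ, h1, h2⟩, h⟩ s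
    have := h (Pi.single (i s) 1)
    simp only [Pi.single_apply, i.injective.eq_iff, ite_mul, one_mul, zero_mul,
      Finset.sum_ite_eq', Finset.mem_univ, if_true] at this
    exact Prod.ext ((h2 _).symm.trans (h1 s)) this.symm
  · intro h
    refine ⟨⟨fun t => (y t).1, fun s => congrArg Prod.fst (h s), fun _ => rfl⟩, fun f => ?_⟩
    rw [← i.sum_comp]
    simp only [h]

theorem behavior_id (n : ℕ) : behavior (id k n) = LinearRelation.id k (k × k) n :=
  LinearRelation.ext' fun _ _ =>
    (mem_behavior_ofEquiv (Equiv.refl _)).trans (funext_iff.symm.trans eq_comm)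

theorem behavior_braid (m n : ℕ) : behavior (braid k m n) = LinearRelation.braid k (k × k) m n :=
  LinearRelation.ext' fun _ _ => (mem_behavior_ofEquiv (swapEquiv m n)).trans (by
    rw [LinearRelation.forall_fin_add, LinearRelation.mem_braid]
    simp only [swapEquiv, Equiv.coe_fn_mk, swap_castAdd, swap_natAdd])

end Circuit

variable (k) in
/-- The black box functor: it sends a linear circuit to its behaviour. -/
def blackBox : PropHom (Circ k) (LagRel k) where
  map := Quotient.lift (fun c => ⟨Circuit.behavior c, Circuit.isLagrangianRelation_behavior c⟩)
    fun _ _ h => Subtype.ext (Circuit.behavior_congr h)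
  map_id n := Subtype.ext (Circuit.behavior_id n)
  map_comp := by rintro _ _ _ ⟨a⟩ ⟨b⟩; exact Subtype.ext (Circuit.behavior_comp a b)
  map_tensor := by rintro _ _ _ _ ⟨a⟩ ⟨b⟩; exact Subtype.ext (Circuit.behavior_tensor a b)
  map_braid m n := Subtype.ext (Circuit.behavior_braid m n)

end BlackBoxing

section Diagrams

/-- The circuit made of perfectly conductive wires, all connected to a single node, for which a
generator stands. -/
def FrobSig.toCircuit {L : Type u} {m n : ℕ} (_ : FrobSig m n) : Circuit L m n :=
  Circuit.ofCospan (N := Unit) (fun _ => ()) fun _ => ()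

/-- The circuit with a single edge for which a label stands. -/
def LabelSig.toCircuit {L : Type u} : ∀ {m n : ℕ}, LabelSig L m n → Circuit L m n
  | _, _, .label l => Circuit.ofLabel l

/-- The morphism of props that sends a circuit diagram to the circuit that it depicts. -/
def circProjection (L : Type u) : PropHom (FreeCirc L) (Circ L) :=
  FreeProp.lift (Circ L) (Sum.elim (fun s => Quotient.mk _ s.toCircuit)
    fun s => Quotient.mk _ s.toCircuit)

variable {k : Type u} [Field k]

theorem mem_behavior_toCircuit {m n : ℕ} (s : FrobSig m n) {x : Fin m → k × k}
    {y : Fin n → k × k} :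
    (x, y) ∈ Circuit.behavior (s.toCircuit : Circuit k m n) ↔
      (∃ φ, (∀ i, (x i).1 = φ) ∧ ∀ j, (y j).1 = φ) ∧ ∑ i, (x i).2 = ∑ j, (y j).2 := by
  refine Circuit.mem_behavior_ofCospan.trans (and_congr ⟨?_, ?_⟩ ⟨fun h => ?_, fun h f => ?_⟩)
  · rintro ⟨φ, h, h'⟩
    exact ⟨φ (), fun i => (h i).symm, fun i => (h' i).symm⟩
  · rintro ⟨φ, h, h'⟩
    exact ⟨fun _ => φ, fun i => (h i).symm, fun i => (h' i).symm⟩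
  · simpa using h 1
  · rw [← Finset.mul_sum, ← Finset.mul_sum, h]

theorem mem_behavior_m {x : Fin 2 → k × k} {y : Fin 1 → k × k} :
    (x, y) ∈ Circuit.behavior (FrobSig.m.toCircuit : Circuit k 2 1) ↔
      (x 0).1 = (x 1).1 ∧ (x 1).1 = (y 0).1 ∧ (x 0).2 + (x 1).2 = (y 0).2 := by
  rw [mem_behavior_toCircuit]
  simp only [Fin.forall_fin_two, Fin.forall_fin_one, Fin.sum_univ_two, Fin.sum_univ_one]
  grind

theorem mem_behavior_i {x : Fin 0 → k × k} {y : Fin 1 → k × k} :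
    (x, y) ∈ Circuit.behavior (FrobSig.i.toCircuit : Circuit k 0 1) ↔ (y 0).2 = 0 := by
  rw [mem_behavior_toCircuit]
  simp [eq_comm]

theorem mem_behavior_d {x : Fin 1 → k × k} {y : Fin 2 → k × k} :
    (x, y) ∈ Circuit.behavior (FrobSig.d.toCircuit : Circuit k 1 2) ↔
      (x 0).1 = (y 0).1 ∧ (y 0).1 = (y 1).1 ∧ (x 0).2 = (y 0).2 + (y 1).2 := by
  rw [mem_behavior_toCircuit]
  simp only [Fin.forall_fin_two, Fin.forall_fin_one, Fin.sum_univ_two, Fin.sum_univ_one]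
  grind

theorem mem_behavior_e {x : Fin 1 → k × k} {y : Fin 0 → k × k} :
    (x, y) ∈ Circuit.behavior (FrobSig.e.toCircuit : Circuit k 1 0) ↔ (x 0).2 = 0 := by
  rw [mem_behavior_toCircuit]
  simp

theorem mem_behavior_label {z : k} {x y : Fin 1 → k × k} :
    (x, y) ∈ Circuit.behavior ((LabelSig.label z).toCircuit : Circuit k 1 1) ↔
      (y 0).1 - (x 0).1 = z * (x 0).2 ∧ (x 0).2 = (y 0).2 := by
  change (∃ φ J, Circuit.IsState (Circuit.ofLabel z) x y φ J) ↔ _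
  let : Fintype (Circuit.ofLabel z).Edge := inferInstanceAs (Fintype Unit)
  have hs (g : Unit → k) : ∑ e : (Circuit.ofLabel z).Edge, g e = g () := Fintype.sum_unique g
  constructor
  · rintro ⟨φ, J, h⟩
    obtain ⟨h1, h2, h3, h4⟩ := (Circuit.isState_iff _ _ _ _ _).1 h
    have key (f : Fin 2 → k) : f 0 * (x 0).2 + (f 1 - f 0) * J () = f 1 * (y 0).2 := by
      have := h4 f
      rw [Fin.sum_univ_one, Fin.sum_univ_one] at this
      exact (congrArg (_ + ·) (hs _).symm).trans this
    have k0 := key ![1, 0]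
    have k1 := key ![0, 1]
    simp at k0 k1
    have e1 : φ (0 : Fin 2) = (x 0).1 := h1 0
    have e2 : φ (1 : Fin 2) = (y 0).1 := h2 0
    have e3 : φ (1 : Fin 2) - φ (0 : Fin 2) = z * J () := h3 ()
    rw [← e1, ← e2, e3]
    exact ⟨by linear_combination -z * k0, by linear_combination k0 + k1⟩
  · rintro ⟨h, h'⟩
    refine ⟨![(x 0).1, (y 0).1], fun _ => (x 0).2, (Circuit.isState_iff _ _ _ _ _).2
      ⟨fun i => ?_, fun i => ?_, fun _ => h, fun f => ?_⟩⟩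
    · rw [Subsingleton.elim i 0]; rfl
    · rw [Subsingleton.elim i 0]; rfl
    · rw [Fin.sum_univ_one, Fin.sum_univ_one]
      refine (congrArg (_ + ·) (hs _)).trans ?_
      change f (0 : Fin 2) * _ + (f (1 : Fin 2) - f (0 : Fin 2)) * _ = f (1 : Fin 2) * _
      rw [h']; ring

/-- The graph of the linear map given by a matrix. -/
def LinearRelation.ofMatrix {m n : ℕ} (A : Matrix (Fin n) (Fin m) k) :
    LinearRelation k k m n where
  carrier := {p | p.2 = A.mulVec p.1}
  add_mem' {p q} hp hq := by
    simp only [Set.mem_ofPred_eq] at hp hq ⊢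
    simp [hp, hq, Matrix.mulVec_add]
  zero_mem' := by simp
  smul_mem' c p hp := by
    simp only [Set.mem_ofPred_eq] at hp ⊢
    simp [hp, Matrix.mulVec_smul]

/-- The relation obtained by exchanging source and target. -/
def LinearRelation.dagger {m n : ℕ} (R : LinearRelation k k m n) : LinearRelation k k n m where
  carrier := {p | (p.2, p.1) ∈ R}
  add_mem' {_ _} h h' := R.add_mem h h'
  zero_mem' := R.zero_mem
  smul_mem' c _ h := R.smul_mem c h

variable (k)

/-- Duplication: the graph of `x ↦ (x, x)`. -/
def duplication : LinearRelation k k 1 2 := .ofMatrix !![1; 1]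

/-- Deletion: the graph of the map from `k` to the zero space. -/
def deletion : LinearRelation k k 1 0 := .ofMatrix 0

/-- Addition: the graph of `(x, y) ↦ x + y`. -/
def addition : LinearRelation k k 2 1 := .ofMatrix !![1, 1]

/-- Zero: the graph of the map from the zero space to `k`. -/
def zero : LinearRelation k k 0 1 := .ofMatrix 0

variable {k}

/-- Multiplication by a scalar: the graph of `x ↦ c x`. -/
def scaling (c : k) : LinearRelation k k 1 1 := .ofMatrix !![c]

theorem mem_duplication {x : Fin 1 → k} {y : Fin 2 → k} :
    (x, y) ∈ duplication k ↔ y 0 = x 0 ∧ y 1 = x 0 := by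
  change y = _ ↔ _
  simp [funext_iff, Fin.forall_fin_two, dotProduct]

theorem mem_dagger_duplication {x : Fin 2 → k} {y : Fin 1 → k} :
    (x, y) ∈ (duplication k).dagger ↔ x 0 = y 0 ∧ x 1 = y 0 := mem_duplication

theorem mem_deletion {x : Fin 1 → k} {y : Fin 0 → k} : (x, y) ∈ deletion k :=
  Subsingleton.elim (α := Fin 0 → k) _ _

theorem mem_dagger_deletion {x : Fin 0 → k} {y : Fin 1 → k} : (x, y) ∈ (deletion k).dagger :=
  mem_deletion

theorem mem_addition {x : Fin 2 → k} {y : Fin 1 → k} :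
    (x, y) ∈ addition k ↔ y 0 = x 0 + x 1 := by
  change y = _ ↔ _
  simp [funext_iff, dotProduct]

theorem mem_dagger_addition {x : Fin 1 → k} {y : Fin 2 → k} :
    (x, y) ∈ (addition k).dagger ↔ x 0 = y 0 + y 1 := mem_addition

theorem mem_zero {x : Fin 0 → k} {y : Fin 1 → k} : (x, y) ∈ zero k ↔ y 0 = 0 := by
  change y = _ ↔ _
  simp [funext_iff]

theorem mem_dagger_zero {x : Fin 1 → k} {y : Fin 0 → k} :
    (x, y) ∈ (zero k).dagger ↔ x 0 = 0 := mem_zero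

theorem mem_scaling {c : k} {x y : Fin 1 → k} : (x, y) ∈ scaling c ↔ y 0 = c * x 0 := by
  change y = _ ↔ _
  simp [funext_iff, dotProduct]

/-- The prop of signal-flow diagrams, free on two copies of `FrobSig` and on the scalars.  The
first copy stands for coduplication, codeletion, duplication and deletion, the second copy for
addition, zero, coaddition and cozero. -/
def SigFlow (k : Type u) : PROP.{u} :=
  FreeProp (Signature.sum (Signature.sum FrobSig FrobSig) (LabelSig k))

/-- The meaning of the first four generators of signal-flow diagrams. -/
def FrobSig.duplicative : ∀ {m n : ℕ}, FrobSig m n → LinearRelation k k m n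
  | _, _, .m => (duplication k).dagger
  | _, _, .i => (deletion k).dagger
  | _, _, .d => duplication k
  | _, _, .e => deletion k

/-- The meaning of the next four generators of signal-flow diagrams. -/
def FrobSig.additive : ∀ {m n : ℕ}, FrobSig m n → LinearRelation k k m n
  | _, _, .m => addition k
  | _, _, .i => zero k
  | _, _, .d => (addition k).dagger
  | _, _, .e => (zero k).dagger

/-- The meaning of the scalars as signal-flow diagrams. -/
def LabelSig.scalar : ∀ {m n : ℕ}, LabelSig k m n → LinearRelation k k m n
  | _, _, .label c => scaling c

variable (k) in
/-- The morphism of props that sends a signal-flow diagram to the linear relation that it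
denotes. -/
def whiteBox : PropHom (SigFlow k) (FinRel k) :=
  FreeProp.lift (FinRel k) (Sum.elim (Sum.elim FrobSig.duplicative FrobSig.additive)
    LabelSig.scalar)

end Diagrams

end CircuitProps

/-!
Potentials and currents do not interact in a junction `s` of wires: `■(s)` is the direct sum of a
relation between potentials, which forces them all to be equal, and a relation between currents,
which forces the incoming ones and the outgoing ones to have the same sum.  These two relations are
the meanings of the two generators `s` of signal-flow diagrams.  Hence `T(s)` sorts the wires into
potentials and currents, puts these two generators side by side, and shuffles the wires back.  Only
Ohm's law mixes the two kinds of wires: it adds to a potential a multiple of the current.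

A strict symmetric monoidal functor that doubles objects is a morphism of props into the full
subprop on the even objects, so the universal property of the free prop yields `T`.  The same
property reduces the commutativity of the square to generators.
-/

namespace CircuitProps

section HeterogeneousEquality

theorem castHom_heq {H : ℕ → ℕ → Type u} {m m' n n' : ℕ} (hm : m = m') (hn : n = n')
    (f : H m n) : castHom hm hn f ≍ f := by
  subst hm hn; rfl

theorem PROP.comp_heq (P : PROP.{u}) {l l' m m' n n' : ℕ} (hl : l = l') (hm : m = m')
    (hn : n = n') {f : P.Hom l m} {f' : P.Hom l' m'} {g : P.Hom m n} {g' : P.Hom m' n'}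
    (hf : f ≍ f') (hg : g ≍ g') : P.comp f g ≍ P.comp f' g' := by
  subst hl hm hn hf hg; rfl

theorem PROP.tensor_heq (P : PROP.{u}) {m m' n n' p p' q q' : ℕ} (hm : m = m') (hn : n = n')
    (hp : p = p') (hq : q = q') {f : P.Hom m n} {f' : P.Hom m' n'} {g : P.Hom p q}
    {g' : P.Hom p' q'} (hf : f ≍ f') (hg : g ≍ g') : P.tensor f g ≍ P.tensor f' g' := by
  subst hm hn hp hq hf hg; rfl

theorem PROP.braid_heq (P : PROP.{u}) {m m' n n' : ℕ} (hm : m = m') (hn : n = n') :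
    P.braid m n ≍ P.braid m' n' := by
  subst hm hn; rfl

theorem PROP.tensor_assoc_heq (P : PROP.{u}) {m n m' n' m'' n'' : ℕ} (f : P.Hom m n)
    (g : P.Hom m' n') (h : P.Hom m'' n'') :
    P.tensor (P.tensor f g) h ≍ P.tensor f (P.tensor g h) :=
  (castHom_heq _ _ _).symm.trans (heq_of_eq (P.tensor_assoc f g h))

theorem PROP.hexagon_heq (P : PROP.{u}) (m n p : ℕ) :
    P.braid m (n + p) ≍ P.comp (castHom rfl (add_assoc n m p) (P.tensor (P.braid m n) (P.id p)))
      (P.tensor (P.id n) (P.braid m p)) :=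
  (castHom_heq _ _ _).symm.trans (heq_of_eq (P.hexagon m n p))

theorem StrictFunctor.map_tensor_heq {P : PROP.{u}} {Q : PROP.{v}} (F : StrictFunctor P Q)
    {m n m' n' : ℕ} (f : P.Hom m n) (g : P.Hom m' n') :
    F.map (P.tensor f g) ≍ Q.tensor (F.map f) (F.map g) :=
  (castHom_heq _ _ _).symm.trans (heq_of_eq (F.map_tensor f g))

theorem StrictFunctor.map_braid_heq {P : PROP.{u}} {Q : PROP.{v}} (F : StrictFunctor P Q)
    (m n : ℕ) : F.map (P.braid m n) ≍ Q.braid (F.obj m) (F.obj n) :=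
  (castHom_heq _ _ _).symm.trans (heq_of_eq (F.map_braid m n))

end HeterogeneousEquality

section Multiples

/-- The full subprop of `P` on the multiples of `d`, with `d * n` renamed to `n`.  A strict
symmetric monoidal functor into `P` that sends `1` to `d` is the same as a morphism of props into
`P.multiple d`. -/
def PROP.multiple (P : PROP.{u}) (d : ℕ) : PROP.{u} where
  Hom m n := P.Hom (d * m) (d * n)
  id n := P.id (d * n)
  comp f g := P.comp f g
  tensor {m n m' n'} f g := castHom (Nat.mul_add d m m').symm (Nat.mul_add d n n').symm
    (P.tensor f g)
  braid m n := castHom (Nat.mul_add d m n).symm (Nat.mul_add d n m).symm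
    (P.braid (d * m) (d * n))
  id_comp f := P.id_comp f
  comp_id f := P.comp_id f
  assoc f g h := P.assoc f g h
  tensor_id m n := eq_of_heq <| (castHom_heq _ _ _).trans <|
    (heq_of_eq (P.tensor_id _ _)).trans (congr_arg_heq P.id (Nat.mul_add d m n).symm)
  tensor_comp f g f' g' := eq_of_heq <| (castHom_heq _ _ _).trans <|
    (heq_of_eq (P.tensor_comp f g f' g')).trans <|
    P.comp_heq (Nat.mul_add ..).symm (Nat.mul_add ..).symm (Nat.mul_add ..).symm
      (castHom_heq _ _ _).symm (castHom_heq _ _ _).symm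
  tensor_assoc f g h := eq_of_heq <| (castHom_heq _ _ _).trans <| (castHom_heq _ _ _).trans <|
    (P.tensor_heq (Nat.mul_add ..) (Nat.mul_add ..) rfl rfl (castHom_heq _ _ _) HEq.rfl).trans <|
    (P.tensor_assoc_heq f g h).trans <|
    (P.tensor_heq rfl rfl (Nat.mul_add ..).symm (Nat.mul_add ..).symm HEq.rfl
      (castHom_heq _ _ _).symm).trans
    (castHom_heq _ _ _).symm
  id_zero_tensor f := eq_of_heq <| (castHom_heq _ _ _).trans <| (castHom_heq _ _ _).trans <|
    (castHom_heq _ _ _).symm.trans (heq_of_eq (P.id_zero_tensor f))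
  tensor_id_zero f := eq_of_heq <| (castHom_heq _ _ _).trans <| (castHom_heq _ _ _).trans <|
    (castHom_heq _ _ _).symm.trans (heq_of_eq (P.tensor_id_zero f))
  braid_natural {m n m' n'} f g := eq_of_heq <|
    (P.comp_heq (Nat.mul_add ..) (Nat.mul_add ..) (Nat.mul_add ..)
      (castHom_heq _ _ _) (castHom_heq _ _ _)).trans <|
    (heq_of_eq (P.braid_natural f g)).trans <|
    P.comp_heq (Nat.mul_add ..).symm (Nat.mul_add ..).symm (Nat.mul_add ..).symm
      (castHom_heq _ _ _).symm (castHom_heq _ _ _).symm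
  braid_symm m n := eq_of_heq <|
    (P.comp_heq (Nat.mul_add ..) (Nat.mul_add ..) (Nat.mul_add ..)
      (castHom_heq _ _ _) (castHom_heq _ _ _)).trans <|
    (heq_of_eq (P.braid_symm _ _)).trans (congr_arg_heq P.id (Nat.mul_add d m n).symm)
  braid_zero n := eq_of_heq <| (castHom_heq _ _ _).trans <| (castHom_heq _ _ _).trans <|
    (castHom_heq _ _ _).symm.trans (heq_of_eq (P.braid_zero (d * n)))
  hexagon m n p := eq_of_heq <| (castHom_heq _ _ _).trans <| (castHom_heq _ _ _).trans <|
    (P.braid_heq rfl (Nat.mul_add d n p)).trans <|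
    (P.hexagon_heq (d * m) (d * n) (d * p)).trans <|
    P.comp_heq (by simp only [Nat.mul_add]) (by simp only [Nat.mul_add])
      (by simp only [Nat.mul_add])
      ((castHom_heq _ _ _).trans <|
        (P.tensor_heq (Nat.mul_add ..).symm (Nat.mul_add ..).symm rfl rfl
          (castHom_heq _ _ _).symm HEq.rfl).trans <|
        (castHom_heq _ _ _).symm.trans
        (castHom_heq (H := fun m n => P.Hom (d * m) (d * n)) _ _ _).symm)
      ((P.tensor_heq rfl rfl (Nat.mul_add ..).symm (Nat.mul_add ..).symm HEq.rfl
        (castHom_heq _ _ _).symm).trans (castHom_heq _ _ _).symm)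

/-- The inclusion of the multiples of `d`, which sends the object `n` to the object `d * n`. -/
def PROP.multipleInclusion (P : PROP.{u}) (d : ℕ) : StrictFunctor (P.multiple d) P where
  obj n := d * n
  map f := f
  obj_zero := rfl
  obj_add m n := Nat.mul_add d m n
  map_id _ := rfl
  map_comp _ _ := rfl
  map_tensor _ _ := castHom_castHom _ _ _ _ _
  map_braid _ _ := castHom_castHom _ _ _ _ _

end Multiples

section FreeProps

theorem StrictFunctor.obj_eq_mul {P : PROP.{u}} {Q : PROP.{v}} (F : StrictFunctor P Q) (n : ℕ) :
    F.obj n = n * F.obj 1 := by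
  induction n with
  | zero => rw [F.obj_zero, Nat.zero_mul]
  | succ n ih => rw [F.obj_add, ih, Nat.succ_mul]

theorem StrictFunctor.ext_heq {P : PROP.{u}} {Q : PROP.{v}} {F G : StrictFunctor P Q}
    (hobj : F.obj = G.obj) (hmap : ∀ {m n} (f : P.Hom m n), F.map f ≍ G.map f) : F = G := by
  cases F
  cases G
  cases hobj
  congr
  funext m n f
  exact eq_of_heq (hmap f)

theorem FreeProp.strictFunctor_ext {S : Signature.{u}} {Q : PROP.{v}}
    {F G : StrictFunctor (FreeProp S) Q} (hobj : F.obj 1 = G.obj 1)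
    (hmap : ∀ {m n} (s : S m n), F.map (FreeProp.of s) ≍ G.map (FreeProp.of s)) : F = G := by
  have hobj' (n : ℕ) : F.obj n = G.obj n := by rw [F.obj_eq_mul, G.obj_eq_mul, hobj]
  refine StrictFunctor.ext_heq (funext hobj') fun f => ?_
  induction f using Quot.ind with | mk f
  induction f with
  | gen s => exact hmap s
  | id n =>
    exact (heq_of_eq (F.map_id n)).trans <| (congr_arg_heq Q.id (hobj' n)).trans
      (heq_of_eq (G.map_id n)).symm
  | comp f g ihf ihg =>
    exact (heq_of_eq (F.map_comp (Quot.mk _ f) (Quot.mk _ g))).trans <|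
      (Q.comp_heq (hobj' _) (hobj' _) (hobj' _) ihf ihg).trans
      (heq_of_eq (G.map_comp (Quot.mk _ f) (Quot.mk _ g))).symm
  | tensor f g ihf ihg =>
    exact (F.map_tensor_heq (Quot.mk _ f) (Quot.mk _ g)).trans <|
      (Q.tensor_heq (hobj' _) (hobj' _) (hobj' _) (hobj' _) ihf ihg).trans
      (G.map_tensor_heq (Quot.mk _ f) (Quot.mk _ g)).symm
  | braid m n =>
    exact (F.map_braid_heq m n).trans <| (Q.braid_heq (hobj' m) (hobj' n)).trans
      (G.map_braid_heq m n).symm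

end FreeProps

section Shuffles

/-- The permutation of wires that sorts `n` interleaved pairs: it sends
`(a₁, b₁, …, aₙ, bₙ)` to `(a₁, …, aₙ, b₁, …, bₙ)`. -/
def PROP.unshuffle (P : PROP.{u}) : ∀ n, P.Hom (2 * n) (n + n)
  | 0 => P.id 0
  | n + 1 => P.comp (m := n + (n + 1) + 1)
      (P.tensor (m := 2 * n) (n := n + n) (P.unshuffle n) (P.id 2))
      (P.tensor (n := n + 1 + n)
        (castHom (H := P.Hom) rfl (add_assoc n 1 n).symm (P.tensor (P.id n) (P.braid n 1)))
        (P.id 1))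

/-- The perfect shuffle of wires, inverse to `PROP.unshuffle`. -/
def PROP.shuffle (P : PROP.{u}) : ∀ n, P.Hom (n + n) (2 * n)
  | 0 => P.id 0
  | n + 1 => P.comp (m := n + (n + 1) + 1)
      (P.tensor (m := n + 1 + n)
        (castHom (H := P.Hom) (add_assoc n 1 n).symm rfl (P.tensor (P.id n) (P.braid 1 n)))
        (P.id 1))
      (P.tensor (m := n + n) (n := 2 * n) (P.shuffle n) (P.id 2))

/-- The morphism that acts by `f` on the first wires and by `g` on the second wires of interleaved
pairs of wires. -/
def PROP.interleave (P : PROP.{u}) {m n : ℕ} (f g : P.Hom m n) : P.Hom (2 * m) (2 * n) :=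
  P.comp (P.unshuffle m) (P.comp (P.tensor f g) (P.shuffle n))

theorem PropHom.map_castHom {P : PROP.{u}} {Q : PROP.{v}} (F : PropHom P Q)
    {m m' n n' : ℕ} (hm : m = m') (hn : n = n') (f : P.Hom m n) :
    F.map (castHom hm hn f) = castHom hm hn (F.map f) :=
  F.toStrictFunctor.map_castHom hm hn f

theorem PropHom.map_unshuffle {P : PROP.{u}} {Q : PROP.{v}} (F : PropHom P Q) (n : ℕ) :
    F.map (P.unshuffle n) = Q.unshuffle n := by
  induction n with
  | zero => exact F.map_id 0
  | succ n ih =>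
    simp only [PROP.unshuffle, F.map_comp, F.map_tensor, F.map_castHom, F.map_id, F.map_braid, ih]

theorem PropHom.map_shuffle {P : PROP.{u}} {Q : PROP.{v}} (F : PropHom P Q) (n : ℕ) :
    F.map (P.shuffle n) = Q.shuffle n := by
  induction n with
  | zero => exact F.map_id 0
  | succ n ih =>
    simp only [PROP.shuffle, F.map_comp, F.map_tensor, F.map_castHom, F.map_id, F.map_braid, ih]

theorem PropHom.map_interleave {P : PROP.{u}} {Q : PROP.{v}} (F : PropHom P Q) {m n : ℕ}
    (f g : P.Hom m n) : F.map (P.interleave f g) = Q.interleave (F.map f) (F.map g) := by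
  simp only [PROP.interleave, F.map_comp, F.map_tensor, F.map_unshuffle, F.map_shuffle]

end Shuffles

section Reindexing

variable {k : Type u} [Field k] {V : Type u} [AddCommGroup V] [Module k V]

namespace LinearRelation

variable (k V) in
/-- The graph of the linear map `V ^ m → V ^ n` that sends `x` to `x ∘ σ`. -/
def reindex {m n : ℕ} (σ : Fin n → Fin m) : LinearRelation k V m n :=
  (LinearMap.funLeft k V σ).graph

theorem mem_reindex {m n : ℕ} {σ : Fin n → Fin m} {x : Fin m → V} {y : Fin n → V} :
    (x, y) ∈ reindex k V σ ↔ y = x ∘ σ :=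
  LinearMap.mem_graph_iff (f := LinearMap.funLeft k V σ) (x, y)

theorem id_eq_reindex (n : ℕ) : id k V n = reindex k V _root_.id :=
  ext' fun _ _ => mem_id.trans (eq_comm.trans mem_reindex.symm)

theorem reindex_comp {l m n : ℕ} (σ : Fin m → Fin l) (τ : Fin n → Fin m) :
    (reindex k V σ).comp (reindex k V τ) = reindex k V (σ ∘ τ) :=
  ext' fun _ _ => by simp only [mem_comp, mem_reindex, exists_eq_left, Function.comp_assoc]

theorem reindex_tensor {m n m' n' : ℕ} (σ : Fin n → Fin m) (σ' : Fin n' → Fin m') :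
    (reindex k V σ).tensor (reindex k V σ') = reindex k V (Circuit.sumMap σ σ') :=
  ext' fun _ _ => by
    simp only [mem_tensor, mem_reindex, funext_iff, forall_fin_add (m := n), Function.comp_apply,
      Circuit.sumMap, Fin.addCases_left, Fin.addCases_right]

theorem braid_eq_reindex (m n : ℕ) : braid k V m n = reindex k V (Circuit.swap n m) :=
  ext' fun _ _ => by
    simp only [mem_braid, mem_reindex, funext_iff, forall_fin_add (m := n), Function.comp_apply,
      Circuit.swap_castAdd, Circuit.swap_natAdd, and_comm]

theorem castHom_reindex {m m' n n' : ℕ} (hm : m = m') (hn : n = n') (σ : Fin n → Fin m) :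
    castHom (H := LinearRelation k V) hm hn (reindex k V σ) =
      reindex k V (Fin.cast hm ∘ σ ∘ Fin.cast hn.symm) := by
  subst hm hn; rfl

end LinearRelation

theorem Circuit.val_sumMap {m n m' n' : ℕ} (σ : Fin m → Fin n) (σ' : Fin m' → Fin n')
    (i : Fin (m + m')) : (sumMap σ σ' i : ℕ) =
      if h : (i : ℕ) < m then (σ ⟨i, h⟩ : ℕ) else n + (σ' ⟨i - m, by omega⟩ : ℕ) := by
  refine Fin.addCases (fun i => ?_) (fun i => ?_) i <;> simp [sumMap]

theorem Circuit.val_swap {m n : ℕ} (i : Fin (m + n)) :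
    (swap m n i : ℕ) = if (i : ℕ) < m then n + i else i - m := by
  refine Fin.addCases (fun i => ?_) (fun i => ?_) i <;> simp [swap]

/-- The position before sorting of each wire of the permutation `PROP.unshuffle`. -/
def unshuffleIndex (n : ℕ) : Fin (n + n) → Fin (2 * n) :=
  Fin.addCases (fun i => ⟨2 * i, by omega⟩) fun i => ⟨2 * i + 1, by omega⟩

theorem unshuffleIndex_castAdd {n : ℕ} (i : Fin n) :
    unshuffleIndex n (Fin.castAdd n i) = ⟨2 * i, by omega⟩ :=
  Fin.addCases_left i

theorem unshuffleIndex_natAdd {n : ℕ} (i : Fin n) :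
    unshuffleIndex n (Fin.natAdd n i) = ⟨2 * i + 1, by omega⟩ :=
  Fin.addCases_right i

theorem val_unshuffleIndex {n : ℕ} (i : Fin (n + n)) :
    (unshuffleIndex n i : ℕ) = if (i : ℕ) < n then 2 * (i : ℕ) else 2 * (i - n : ℕ) + 1 := by
  refine Fin.addCases (fun i => ?_) (fun i => ?_) i
  · rw [unshuffleIndex_castAdd]; simp
  · rw [unshuffleIndex_natAdd]; simp

theorem unshuffleIndex_succ (n : ℕ) : unshuffleIndex (n + 1) =
    Circuit.sumMap (m := n + n) (n := 2 * n) (m' := 2) (n' := 2) (unshuffleIndex n) id ∘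
      Circuit.sumMap (m := n + 1 + n) (m' := 1) (n' := 1)
        (Circuit.sumMap (m := n) (n := n) id (Circuit.swap 1 n) ∘ Fin.cast (add_assoc n 1 n))
        id := by
  ext i
  simp only [Function.comp_apply, val_unshuffleIndex, Circuit.val_sumMap, Circuit.val_swap,
    Fin.val_cast, id_eq]
  split_ifs <;> omega

theorem LinRel.unshuffle_eq_reindex (n : ℕ) :
    (LinRel k V).unshuffle n = LinearRelation.reindex k V (unshuffleIndex n) := by
  induction n with
  | zero => exact (LinearRelation.id_eq_reindex 0).trans (congrArg _ (Subsingleton.elim _ _))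
  | succ n ih =>
    rw [PROP.unshuffle, ih]
    dsimp only [LinRel]
    simp only [LinearRelation.id_eq_reindex, LinearRelation.braid_eq_reindex,
      LinearRelation.reindex_tensor, LinearRelation.castHom_reindex, LinearRelation.reindex_comp,
      unshuffleIndex_succ]
    rfl

end Reindexing

section Daggers

variable {k : Type u} [Field k]

namespace LinearRelation

theorem mem_dagger {m n : ℕ} {L : LinearRelation k k m n} {x : Fin n → k} {y : Fin m → k} :
    (x, y) ∈ L.dagger ↔ (y, x) ∈ L := Iff.rfl

theorem dagger_id (n : ℕ) : (id k k n).dagger = id k k n :=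
  ext' fun _ _ => eq_comm

theorem dagger_comp {l m n : ℕ} (L : LinearRelation k k l m) (M : LinearRelation k k m n) :
    (L.comp M).dagger = M.dagger.comp L.dagger :=
  ext' fun _ _ => exists_congr fun _ => and_comm

theorem dagger_tensor {m n m' n' : ℕ} (L : LinearRelation k k m n)
    (M : LinearRelation k k m' n') : (L.tensor M).dagger = L.dagger.tensor M.dagger :=
  rfl

theorem dagger_braid (m n : ℕ) : (braid k k m n).dagger = braid k k n m :=
  ext' fun _ _ => by simp only [mem_dagger, mem_braid, eq_comm, and_comm]

theorem dagger_castHom {m m' n n' : ℕ} (hm : m = m') (hn : n = n') (L : LinearRelation k k m n) :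
    dagger (castHom (H := LinearRelation k k) hm hn L) =
      castHom (H := LinearRelation k k) hn hm L.dagger := by
  subst hm hn; rfl

end LinearRelation

theorem FinRel.shuffle_eq_dagger (n : ℕ) :
    (FinRel k).shuffle n = LinearRelation.dagger ((FinRel k).unshuffle n) := by
  induction n with
  | zero => exact (LinearRelation.dagger_id 0).symm
  | succ n ih =>
    rw [PROP.shuffle, PROP.unshuffle, ih]
    dsimp only [FinRel, LinRel]
    simp only [LinearRelation.dagger_comp, LinearRelation.dagger_tensor,
      LinearRelation.dagger_castHom, LinearRelation.dagger_id, LinearRelation.dagger_braid]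

end Daggers

section Pairs

theorem comp_unshuffleIndex_castAdd {k : Type u} {n : ℕ} (x : Fin (2 * n) → k) :
    (fun i => (x ∘ unshuffleIndex n) (Fin.castAdd n i)) = Prod.fst ∘ pairUp x :=
  funext fun i => congrArg x (unshuffleIndex_castAdd i)

theorem comp_unshuffleIndex_natAdd {k : Type u} {n : ℕ} (x : Fin (2 * n) → k) :
    (fun i => (x ∘ unshuffleIndex n) (Fin.natAdd n i)) = Prod.snd ∘ pairUp x :=
  funext fun i => congrArg x (unshuffleIndex_natAdd i)

variable {k : Type u} [Field k] {V W : Type u} [AddCommGroup V] [Module k V] [AddCommGroup W]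
  [Module k W]

/-- The relation between pairs of vectors that relates the first components by `L` and the second
components by `M`. -/
def LinearRelation.pair {m n : ℕ} (L : LinearRelation k V m n) (M : LinearRelation k W m n) :
    LinearRelation k (V × W) m n where
  carrier := {p | (Prod.fst ∘ p.1, Prod.fst ∘ p.2) ∈ L ∧ (Prod.snd ∘ p.1, Prod.snd ∘ p.2) ∈ M}
  add_mem' h h' := ⟨L.add_mem h.1 h'.1, M.add_mem h.2 h'.2⟩
  zero_mem' := ⟨L.zero_mem, M.zero_mem⟩
  smul_mem' c _ h := ⟨L.smul_mem c h.1, M.smul_mem c h.2⟩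

theorem LinearRelation.mem_pair {m n : ℕ} {L : LinearRelation k V m n} {M : LinearRelation k W m n}
    {x : Fin m → V × W} {y : Fin n → V × W} : (x, y) ∈ L.pair M ↔
      (Prod.fst ∘ x, Prod.fst ∘ y) ∈ L ∧ (Prod.snd ∘ x, Prod.snd ∘ y) ∈ M :=
  Iff.rfl

open LinearRelation in
theorem FinRel.interleave_eq_flattenRelation_pair {m n : ℕ} (L M : LinearRelation k k m n) :
    (FinRel k).interleave L M = flattenRelation (L.pair M) := by
  have h : (FinRel k).interleave L M = (reindex k k (unshuffleIndex m)).comp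
      ((L.tensor M).comp (reindex k k (unshuffleIndex n)).dagger) := by
    rw [← LinRel.unshuffle_eq_reindex, ← LinRel.unshuffle_eq_reindex]
    exact congrArg _ (congrArg _ (FinRel.shuffle_eq_dagger n))
  refine h.trans <| ext' fun x y => ?_
  simp only [mem_comp, mem_dagger, mem_reindex, exists_eq_left, exists_eq_right, mem_tensor,
    comp_unshuffleIndex_castAdd, comp_unshuffleIndex_natAdd, mem_flattenRelation, mem_pair]

end Pairs

section Translation

variable {k : Type u} [Field k]

theorem FrobSig.mem_duplicative {m n : ℕ} (s : FrobSig m n) {x : Fin m → k} {y : Fin n → k} :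
    (x, y) ∈ (s.duplicative : LinearRelation k k m n) ↔ ∃ φ, (∀ i, x i = φ) ∧ ∀ j, y j = φ := by
  cases s <;>
    simp [duplicative, LinearRelation.mem_dagger, mem_duplication, mem_deletion,
      Fin.forall_fin_two, and_comm]

theorem FrobSig.mem_additive {m n : ℕ} (s : FrobSig m n) {x : Fin m → k} {y : Fin n → k} :
    (x, y) ∈ (s.additive : LinearRelation k k m n) ↔ ∑ i, x i = ∑ j, y j := by
  cases s <;> simp [additive, LinearRelation.mem_dagger, mem_addition, mem_zero, eq_comm]

theorem FrobSig.behavior_toCircuit {m n : ℕ} (s : FrobSig m n) :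
    Circuit.behavior (s.toCircuit : Circuit k m n) = s.duplicative.pair s.additive :=
  LinearRelation.ext' fun x y => by
    simp only [mem_behavior_toCircuit, LinearRelation.mem_pair, mem_duplicative, mem_additive,
      Function.comp_apply]

namespace SigFlow

/-- The generators of the first copy of `FrobSig` in `SigFlow k`: coduplication, codeletion,
duplication and deletion. -/
def duplicative {m n : ℕ} (s : FrobSig m n) : (SigFlow k).Hom m n :=
  FreeProp.of (Sum.inl (Sum.inl s))

/-- The generators of the second copy of `FrobSig` in `SigFlow k`: addition, zero, coaddition and
cozero. -/
def additive {m n : ℕ} (s : FrobSig m n) : (SigFlow k).Hom m n :=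
  FreeProp.of (Sum.inl (Sum.inr s))

/-- The generators of `SigFlow k` that multiply by a scalar. -/
def scalar (c : k) : (SigFlow k).Hom 1 1 :=
  FreeProp.of (Sum.inr (LabelSig.label c))

end SigFlow

variable (k) in
/-- The signal-flow diagram of a junction of wires.  Potentials are duplicated and currents are
added. -/
def FrobSig.toSigFlow {m n : ℕ} (s : FrobSig m n) : (SigFlow k).Hom (2 * m) (2 * n) :=
  (SigFlow k).interleave (SigFlow.duplicative s) (SigFlow.additive s)

theorem FrobSig.whiteBox_map_toSigFlow {m n : ℕ} (s : FrobSig m n) :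
    (whiteBox k).map (s.toSigFlow k) = flattenRelation (Circuit.behavior s.toCircuit) := by
  rw [toSigFlow, PropHom.map_interleave, behavior_toCircuit]
  exact FinRel.interleave_eq_flattenRelation_pair _ _

/-- The signal-flow diagram of an edge: the current is duplicated, and one copy, multiplied by the
label of the edge, is added to the potential. -/
def LabelSig.toSigFlow : ∀ {m n : ℕ}, LabelSig k m n → (SigFlow k).Hom (2 * m) (2 * n)
  | _, _, .label z =>
    let P := SigFlow k
    P.comp (l := 1 + 1) (m := 1 + (1 + 1)) (n := 1 + 1)
      (P.tensor (P.id 1)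
        (P.comp (SigFlow.duplicative .d) (P.tensor (SigFlow.scalar z) (P.id 1))))
      (P.tensor (m := 1 + 1) (SigFlow.additive .m) (P.id 1))

/-- The relation that adds `z` times the second coordinate to the first one, composed in the same
way as the signal-flow diagram `LabelSig.toSigFlow`. -/
def LinearRelation.shear (z : k) : LinearRelation k k 2 2 :=
  ((LinearRelation.id k k 1).tensor
    (comp (m := 1 + 1) (duplication k) ((scaling z).tensor (.id k k 1)))).comp
      (tensor (m := 1 + 1) (addition k) (.id k k 1))

theorem LinearRelation.mem_shear {z : k} {x y : Fin 2 → k} :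
    (x, y) ∈ shear z ↔ y 0 - x 0 = z * x 1 ∧ x 1 = y 1 := by
  constructor
  · rintro ⟨u, ⟨h₀, v, hdup, hscale, h₁⟩, hadd, h₂⟩
    have hx : x 0 = u 0 := congrFun h₀ 0
    have hv : v 0 = x 1 ∧ v 1 = x 1 := mem_duplication.1 hdup
    have hz : u 1 = z * v 0 := mem_scaling.1 hscale
    have hu : v 1 = u 2 := congrFun h₁ 0
    have hy : y 0 = u 0 + u 1 := mem_addition.1 hadd
    have hy' : u 2 = y 1 := congrFun h₂ 0
    grind
  · rintro ⟨h, h'⟩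
    exact ⟨![x 0, z * x 1, x 1],
      ⟨funext (Fin.forall_fin_one.2 rfl), ![x 1, x 1], mem_duplication.2 ⟨rfl, rfl⟩,
        mem_scaling.2 rfl, funext (Fin.forall_fin_one.2 rfl)⟩,
      mem_addition.2 (eq_add_of_sub_eq' h), funext (Fin.forall_fin_one.2 h')⟩

theorem LabelSig.whiteBox_map_toSigFlow {m n : ℕ} (s : LabelSig k m n) :
    (whiteBox k).map s.toSigFlow = flattenRelation (Circuit.behavior s.toCircuit) := by
  obtain ⟨z⟩ := s
  exact LinearRelation.ext' fun x y => LinearRelation.mem_shear.trans <|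
    (mem_behavior_label (x := pairUp x) (y := pairUp y)).symm

variable (k) in
/-- The translation of circuit diagrams to signal-flow diagrams, in which each wire becomes a pair
of wires that carry its potential and its current. -/
def circToSigFlow : StrictFunctor (FreeCirc k) (SigFlow k) :=
  (FreeProp.lift ((SigFlow k).multiple 2)
    (Sum.elim (FrobSig.toSigFlow k) LabelSig.toSigFlow)).toStrictFunctor.comp
    ((SigFlow k).multipleInclusion 2)

end Translation

end CircuitProps

theorem mainTheorem6 (k : Type u) [Field k] :
    ∃ T : CircuitProps.StrictFunctor (CircuitProps.FreeCirc k) (CircuitProps.SigFlow k),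
      T.obj 1 = 2 ∧
      T.comp (CircuitProps.whiteBox k).toStrictFunctor =
        ((CircuitProps.circProjection k).toStrictFunctor.comp
          (CircuitProps.blackBox k).toStrictFunctor).comp (CircuitProps.LagRel.inclusion k) := by
  refine ⟨CircuitProps.circToSigFlow k, rfl, CircuitProps.FreeProp.strictFunctor_ext rfl ?_⟩
  rintro m n (s | s)
  · exact heq_of_eq s.whiteBox_map_toSigFlow
  · exact heq_of_eq s.whiteBox_map_toSigFlow
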